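/- Let $\mathcal X\subset\mathbb R$ be a bounded interval with $d(x,y)=|x-y|$, let $f:\mathcal X\to\mathcal X$ be measurable, and let $\mu$ be an ergodic $f$-invariant probability measure on $\mathcal X$ that is absolutely continuous with respect to Lebesgue measure, with density $\rho\ge 0$ of bounded variation on $\mathcal X$. Assume: (A1) There are $C,c>0$ such that, for all $\varphi_1:\mathcal X\to\mathbb R$ of bounded variation, all $\varphi_2\in L^1(\mu)$ and all $j\ge 0$, $$\Bigl|\int\varphi_1\cdot\varphi_2\circ f^j\,d\mu-\int\varphi_1\,d\mu\int\varphi_2\,d\mu\Bigr|\le Ce^{-cj}\,\|\varphi_1\|_{\mathrm{BV}}\,\|\varphi_2\|_{L^1(\mu)},\qquad \|\varphi\|_{\mathrm{BV}}=\mathrm{var}(\varphi)+\sup_{\mathcal X}|\varphi|.$$ (A2) For every $a>0$ and every sequence $(s_n)$ for which there is a constant $K>1$ with $K^{-1}\le s_n/n^{-a}\le K$ for all large $n$, there are $\beta_0\in(0,1)$ and $C>0$ such that, for all large $n$ and all integers $1\le j\le(\log n)^2$, $$\mu\{x\in\mathcal X: d(x,f^jx)\le s_n\}\le C s_n^{\beta_0}.$$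 Let $(r_n)_{n\ge1}$ be a sequence of real numbers. "Eventually" means for all sufficiently large $n$ (depending on $x$), and minima are over $1\le k\le n$. (a) (Almost sure upper bounds.) Suppose that one of the following holds. (i) $\rho>0$ on $\mathcal X$ and, for all large $n$, $r_n>\dfrac{c\log\log n}{n}$, where $c$ is a constant with $2c\,\inf_{\mathcal X}\rho>1$. (ii) $\rho$ is uniformly Hölder continuous on $\mathcal X$ and there are real numbers $\gamma>\gamma_0$ such that $r_n>\dfrac{(\log n)^\gamma}{2n}$ for all large $n$ and $$\sum_{k\ge1}\int_{\mathcal X}\rho(x)e^{-\epsilon k^{\gamma_0}\rho(x)}\,dx<\infty\qquad\text{for every }\epsilon>0.$$ Then for $\mu$-a.e. $x$, $\min_{k\le n}d(f^kx,x)<r_n$ eventually. (b) (Almost sure lower bound.) Suppose that $(r_n)$ is non-increasing and $\sum_{n\ge1}\int_{\mathcal X}\mu(B(x,r_n))\,d\mu(x)<\infty$, where $B(x,r)=\{y:d(x,y)\le r\}$. Then for $\mu$-a.e. $x$, $\min_{k\le n}d(f^kx,x)>r_n$ eventually. -/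

import Mathlib

open MeasureTheory Filter Topology

namespace Recurrence

/-- The norm `‖φ‖_BV = var(φ) + sup |φ|` of a real function on `X ⊆ ℝ`. It is used only for `φ` of
bounded variation on a nonempty interval, where both terms are finite. -/
noncomputable def bvNorm (X : Set ℝ) (φ : ℝ → ℝ) : ℝ :=
  (eVariationOn φ X).toReal + sSup ((fun x => |φ x|) '' X)

/-- Decay of correlations of `BV(X)` against `L¹(μ)` with rate function `Θ`. -/
def DecayOfCorrelations (X : Set ℝ) (f : ℝ → ℝ) (μ : Measure ℝ) (Θ : ℕ → ℝ) : Prop :=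
  ∀ φ₁ φ₂ : ℝ → ℝ, BoundedVariationOn φ₁ X → Integrable φ₂ μ → ∀ j : ℕ,
    |(∫ x, φ₁ x * φ₂ (f^[j] x) ∂μ) - (∫ x, φ₁ x ∂μ) * ∫ x, φ₂ x ∂μ|
      ≤ Θ j * bvNorm X φ₁ * ∫ x, |φ₂ x| ∂μ

/-- Exponential decay of correlations of `BV(X)` against `L¹(μ)`. -/
def ExpDecayOfCorrelations (X : Set ℝ) (f : ℝ → ℝ) (μ : Measure ℝ) : Prop :=
  ∃ C > (0 : ℝ), ∃ c > (0 : ℝ), DecayOfCorrelations X f μ (fun j => C * Real.exp (-c * j))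

/-- `a_n ≈ b_n`: the ratio lies in `[c⁻¹, c]` for all large `n`, for some constant `c > 1`. -/
def Comparable (a b : ℕ → ℝ) : Prop :=
  ∃ c > (1 : ℝ), ∀ᶠ n in atTop, a n / b n ∈ Set.Icc c⁻¹ c

/-- The set `E_j(r)` of points of `X` that return to within distance `r` at time `j`. -/
def closeReturnSet (X : Set ℝ) (f : ℝ → ℝ) (j : ℕ) (r : ℝ) : Set ℝ :=
  {x ∈ X | dist x (f^[j] x) ≤ r}

/-- Short-time recurrence estimate: whenever `r_n ≈ n^{-a}` with `a > 0`, there are `β ∈ (0,1)` and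
`C > 0` with `μ(E_j(r_n)) ≤ C r_n^β` for all large `n` and all `1 ≤ j ≤ (log n)²`. -/
def ShortRecurrenceBound (X : Set ℝ) (f : ℝ → ℝ) (μ : Measure ℝ) : Prop :=
  ∀ a > (0 : ℝ), ∀ r : ℕ → ℝ, Comparable r (fun n => (n : ℝ) ^ (-a)) →
    ∃ β ∈ Set.Ioo (0 : ℝ) 1, ∃ C > (0 : ℝ), ∀ᶠ n : ℕ in atTop, ∀ j : ℕ, 1 ≤ j →
      (j : ℝ) ≤ Real.log n ^ 2 → μ.real (closeReturnSet X f j (r n)) ≤ C * r n ^ β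

/-- `(X, f, μ)` is a hyperbolic recurrent system on the bounded interval `X`, where `μ` is an
ergodic `f`-invariant probability measure with density `ρ` of bounded variation on `X`.
The values of `f` and `ρ` outside `X` play no role. -/
structure HyperbolicRecurrent (X : Set ℝ) (f : ℝ → ℝ) (μ : Measure ℝ) (ρ : ℝ → ℝ) : Prop where
  ordConnected : X.OrdConnected
  isBounded : Bornology.IsBounded X
  mapsTo : Set.MapsTo f X X
  isProbabilityMeasure : IsProbabilityMeasure μ
  /-- This includes measurability of `f` and invariance of `μ`. -/
  ergodic : Ergodic f μ
  density_nonneg : ∀ x ∈ X, 0 ≤ ρ x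
  density_bv : BoundedVariationOn ρ X
  eq_withDensity : μ = (volume.restrict X).withDensity (fun x => ENNReal.ofReal (ρ x))
  expDecay : ExpDecayOfCorrelations X f μ
  shortRecurrence : ShortRecurrenceBound X f μ

/-- `min_{1 ≤ k ≤ n} d(f^k x, x)` (a minimum over a finite nonempty set as soon as `n ≥ 1`). -/
noncomputable def minReturnDist (f : ℝ → ℝ) (n : ℕ) (x : ℝ) : ℝ :=
  sInf ((fun k : ℕ => dist (f^[k] x) x) '' Set.Icc 1 n)

end Recurrence

/-!
Upper bounds. Up to time `n`, cut the orbit into `M` blocks of length `p ≤ (log n) ^ 2` separated by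
gaps of length `q` of order `log n`. By (A2), during a single block the returns of a small set to
itself hardly overlap, so by decay of correlations a point near `y` avoids the ball `B(y, r)` during
one block with probability about `1 - p * μ(B(y, r))`, and the gaps make different blocks nearly
independent. Covering `X` by short cells on which the reference point is almost constant bounds the
set of points that do not come back within `r` before time `n` by `∫ exp (-n * μ(B(y, r))) dμ(y)`,
up to negligible errors. Along geometric times `n = θ ^ k` these bounds are summable, and
Borel–Cantelli together with monotonicity between consecutive geometric times gives the result.

Lower bound. Decay of correlations at time `k`, applied to cells of length `r`, bounds the measure
of `{x | d(x, f^k x) ≤ r}` by a multiple of `∫ μ(B(x, r)) dμ(x)` plus an exponentially small term,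
so Borel–Cantelli controls all large `k`. The remaining finitely many `k` are harmless since (A2)
makes periodic points negligible while `r n` eventually drops below any positive level.
-/

namespace Recurrence

/-! ### Decay of correlations for indicators of intervals -/

theorem eVariationOn_sub_le {α E : Type*} [LinearOrder α] [SeminormedAddCommGroup E]
    (u v : α → E) (s : Set α) :
    eVariationOn (u - v) s ≤ eVariationOn u s + eVariationOn v s := by
  refine iSup_le fun ⟨n, w, hw, hws⟩ => ?_
  calc ∑ i ∈ Finset.range n, edist ((u - v) (w (i + 1))) ((u - v) (w i))
      ≤ ∑ i ∈ Finset.range n,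
          (edist (u (w (i + 1))) (u (w i)) + edist (v (w (i + 1))) (v (w i))) :=
        Finset.sum_le_sum fun i _ => by
          simp only [Pi.sub_apply, sub_eq_add_neg]
          exact (edist_add_add_le _ _ _ _).trans_eq (by rw [edist_neg_neg])
    _ ≤ eVariationOn u s + eVariationOn v s := by
        rw [Finset.sum_add_distrib]
        exact add_le_add (eVariationOn.sum_le hw hws) (eVariationOn.sum_le hw hws)

theorem eVariationOn_le_of_monotoneOn {α : Type*} [LinearOrder α] {g : α → ℝ} {s : Set α}
    {a b : ℝ} (hg : MonotoneOn g s) (hab : ∀ x ∈ s, g x ∈ Set.Icc a b) :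
    eVariationOn g s ≤ ENNReal.ofReal (b - a) := by
  rw [eVariationOn.eq_biSup_inter_Icc]
  refine iSup₂_le fun ⟨x, y⟩ ⟨hx, hy, _⟩ => (hg.eVariationOn_eq hx hy).trans_le ?_
  exact ENNReal.ofReal_le_ofReal (sub_le_sub (hab y hy).2 (hab x hx).1)

theorem eVariationOn_indicator_isUpperSet_le {α : Type*} [LinearOrder α] {U : Set α}
    (hU : IsUpperSet U) (s : Set α) : eVariationOn (U.indicator (1 : α → ℝ)) s ≤ 1 := by
  have hmono : Monotone (U.indicator (1 : α → ℝ)) := fun x y hxy => by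
    by_cases hx : x ∈ U
    · simp [hx, hU hxy hx]
    · rw [Set.indicator_of_notMem hx]
      exact Set.indicator_nonneg (fun _ _ => zero_le_one) y
  have hmem : ∀ x ∈ s, U.indicator (1 : α → ℝ) x ∈ Set.Icc (0 : ℝ) 1 := fun x _ =>
    ⟨Set.indicator_nonneg (fun _ _ => zero_le_one) x, Set.indicator_le_self' (by simp) x⟩
  simpa using eVariationOn_le_of_monotoneOn (hmono.monotoneOn s) hmem

/-- An order-convex set is its upper closure minus the part of the upper closure above it, so its
indicator is a difference of two monotone functions. -/
theorem eVariationOn_indicator_ordConnected_le {α : Type*} [LinearOrder α] {I : Set α}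
    (hI : I.OrdConnected) (s : Set α) : eVariationOn (I.indicator (1 : α → ℝ)) s ≤ 2 := by
  have hupper : IsUpperSet ((upperClosure I : Set α) \ I) := by
    rintro x y hxy ⟨⟨i, hi, hix⟩, hx⟩
    exact ⟨⟨i, hi, hix.trans hxy⟩, fun hy => hx (hI.out hi hy ⟨hix, hxy⟩)⟩
  have hdiff : I.indicator (1 : α → ℝ) = (upperClosure I : Set α).indicator 1 -
      ((upperClosure I : Set α) \ I).indicator 1 := by
    rw [Set.indicator_sdiff subset_upperClosure, sub_sub_cancel]
  calc eVariationOn (I.indicator (1 : α → ℝ)) s ≤ 1 + 1 := by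
        rw [hdiff]
        exact (eVariationOn_sub_le _ _ s).trans (add_le_add
          (eVariationOn_indicator_isUpperSet_le (upperClosure I).upper s)
          (eVariationOn_indicator_isUpperSet_le hupper s))
    _ = 2 := one_add_one_eq_two

theorem bvNorm_indicator_le {I : Set ℝ} (hI : I.OrdConnected) (X : Set ℝ) :
    bvNorm X (I.indicator 1) ≤ 3 := by
  have hvar : (eVariationOn (I.indicator (1 : ℝ → ℝ)) X).toReal ≤ 2 := by
    simpa using ENNReal.toReal_mono (by simp) (eVariationOn_indicator_ordConnected_le hI X)
  have hsup : sSup ((fun x => |I.indicator (1 : ℝ → ℝ) x|) '' X) ≤ 1 := by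
    refine Real.sSup_le ?_ zero_le_one
    rintro _ ⟨x, _, rfl⟩
    by_cases hx : x ∈ I <;> simp [hx]
  calc bvNorm X (I.indicator 1) ≤ 2 + 1 := add_le_add hvar hsup
    _ = 3 := by norm_num

theorem DecayOfCorrelations.abs_measureReal_inter_sub_le {X : Set ℝ} {f : ℝ → ℝ} {μ : Measure ℝ}
    [IsFiniteMeasure μ] {Θ : ℕ → ℝ} (h : DecayOfCorrelations X f μ Θ) (hf : Measurable f)
    {I F : Set ℝ} (hI : I.OrdConnected) (hF : MeasurableSet F) {j : ℕ} (hj : 0 ≤ Θ j) :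
    |μ.real (I ∩ f^[j] ⁻¹' F) - μ.real I * μ.real F| ≤ 3 * Θ j * μ.real F := by
  have hbv : BoundedVariationOn (I.indicator (1 : ℝ → ℝ)) X :=
    ((eVariationOn_indicator_ordConnected_le hI X).trans_lt (by simp)).ne
  have hcorr := h (I.indicator 1) (F.indicator 1) hbv ((integrable_const (1 : ℝ)).indicator hF) j
  have hprod : ∫ x, I.indicator 1 x * F.indicator 1 (f^[j] x) ∂μ =
      μ.real (I ∩ f^[j] ⁻¹' F) := by
    rw [← integral_indicator_one (hI.measurableSet.inter (hf.iterate j hF)),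
      Set.inter_indicator_one]
    rfl
  have habs : ∫ x, |F.indicator (1 : ℝ → ℝ) x| ∂μ = μ.real F := by
    have hnonneg : ∀ x, 0 ≤ F.indicator (1 : ℝ → ℝ) x :=
      Set.indicator_nonneg fun _ _ => zero_le_one
    simp only [abs_of_nonneg (hnonneg _), integral_indicator_one hF]
  rw [hprod, habs, integral_indicator_one hF, integral_indicator_one hI.measurableSet] at hcorr
  calc _ ≤ Θ j * bvNorm X (I.indicator 1) * μ.real F := hcorr
    _ ≤ Θ j * 3 * μ.real F := by gcongr; exact bvNorm_indicator_le hI X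
    _ = 3 * Θ j * μ.real F := by ring

/-- The set `A` is decorrelated, with error `D`, from everything that happens after time `q`. -/
def IsDecorrelated {α : Type*} [MeasurableSpace α] (f : α → α) (μ : Measure α) (D : ℝ) (q : ℕ)
    (A : Set α) : Prop :=
  ∀ F, MeasurableSet F → ∀ j ≥ q,
    |μ.real (A ∩ f^[j] ⁻¹' F) - μ.real A * μ.real F| ≤ D * μ.real F

section IsDecorrelated

variable {α : Type*} [MeasurableSpace α] {f : α → α} {μ : Measure α} {D : ℝ} {q : ℕ} {A F : Set α}

theorem IsDecorrelated.le_measureReal_inter (h : IsDecorrelated f μ D q A) (hF : MeasurableSet F)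
    {j : ℕ} (hj : q ≤ j) : (μ.real A - D) * μ.real F ≤ μ.real (A ∩ f^[j] ⁻¹' F) := by
  linarith [(abs_le.1 (h F hF j hj)).1]

theorem IsDecorrelated.measureReal_inter_le (h : IsDecorrelated f μ D q A) (hF : MeasurableSet F)
    {j : ℕ} (hj : q ≤ j) : μ.real (A ∩ f^[j] ⁻¹' F) ≤ (μ.real A + D) * μ.real F := by
  linarith [(abs_le.1 (h F hF j hj)).2]

end IsDecorrelated

theorem ExpDecayOfCorrelations.exists_isDecorrelated {X : Set ℝ} {f : ℝ → ℝ} {μ : Measure ℝ}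
    [IsFiniteMeasure μ] (h : ExpDecayOfCorrelations X f μ) (hf : Measurable f) :
    ∃ C > (0 : ℝ), ∃ c > (0 : ℝ), ∀ (q : ℕ) (I : Set ℝ), I.OrdConnected →
      IsDecorrelated f μ (C * Real.exp (-c * q)) q I := by
  obtain ⟨C, hC, c, hc, hdecay⟩ := h
  refine ⟨3 * C, by positivity, c, hc, fun q I hI F hF j hj => ?_⟩
  calc _ ≤ 3 * (C * Real.exp (-c * j)) * μ.real F :=
        hdecay.abs_measureReal_inter_sub_le hf hI hF (by positivity)
    _ ≤ 3 * C * Real.exp (-c * q) * μ.real F := by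
        rw [← mul_assoc 3 C]
        gcongr 3 * C * Real.exp ?_ * _
        exact mul_le_mul_of_nonpos_left (Nat.cast_le.2 hj) (neg_nonpos.2 hc.le)

/-! ### Avoiding a set for a long time -/

section Avoidance

variable {α : Type*} {f : α → α} {B : Set α}

/-- The points whose orbit avoids `B` at all times `0 ≤ j < n`. -/
def avoidSet (f : α → α) (B : Set α) (n : ℕ) : Set α := {x | ∀ j < n, f^[j] x ∉ B}

theorem avoidSet_zero (f : α → α) (B : Set α) : avoidSet f B 0 = Set.univ := by
  simp [avoidSet]

theorem avoidSet_succ (f : α → α) (B : Set α) (n : ℕ) :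
    avoidSet f B (n + 1) = avoidSet f B n \ f^[n] ⁻¹' B := by
  ext x
  simp only [avoidSet, Set.mem_ofPred_eq, Set.mem_sdiff, Set.mem_preimage, Nat.forall_lt_succ_right]

theorem avoidSet_subset_inter_preimage (f : α → α) (B : Set α) {p l m n : ℕ} (hp : p ≤ n)
    (hlm : l + m ≤ n) : avoidSet f B n ⊆ avoidSet f B p ∩ f^[l] ⁻¹' avoidSet f B m := by
  refine fun x hx => ⟨fun j hj => hx j (hj.trans_le hp), fun j hj => ?_⟩
  rw [← Function.iterate_add_apply]
  exact hx _ (by omega)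

theorem preimage_iterate_inter_preimage_iterate (A B : Set α) {i j : ℕ} (hij : i ≤ j) :
    f^[i] ⁻¹' A ∩ f^[j] ⁻¹' B = f^[i] ⁻¹' (A ∩ f^[j - i] ⁻¹' B) := by
  rw [Set.preimage_inter, ← Set.preimage_comp, ← Function.iterate_add, Nat.sub_add_cancel hij]

variable [MeasurableSpace α] {μ : Measure α}

theorem measurableSet_avoidSet (hf : Measurable f) (hB : MeasurableSet B) (n : ℕ) :
    MeasurableSet (avoidSet f B n) := by
  induction n with
  | zero => rw [avoidSet_zero]; exact .univ
  | succ n ih => rw [avoidSet_succ]; exact ih.diff (hf.iterate n hB)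

/-- The total measure of the returns of `B` to itself at the times `1, …, p`; it bounds the overlap
of the events `f^[j] ⁻¹' B` within a block of length `p`. -/
noncomputable def returnSum (f : α → α) (μ : Measure α) (B : Set α) (p : ℕ) : ℝ :=
  ∑ j ∈ Finset.Icc 1 p, μ.real (B ∩ f^[j] ⁻¹' B)

theorem returnSum_nonneg (p : ℕ) : 0 ≤ returnSum f μ B p :=
  Finset.sum_nonneg fun _ _ => measureReal_nonneg

theorem returnSum_mono : Monotone (returnSum f μ B) := fun _ _ hpq =>
  Finset.sum_le_sum_of_subset_of_nonneg (Finset.Icc_subset_Icc_right hpq)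
    fun _ _ _ => measureReal_nonneg

theorem measureReal_preimage_iterate_inter (hf : MeasurePreserving f μ μ) {A B : Set α}
    (hA : MeasurableSet A) (hB : MeasurableSet B) {i j : ℕ} (hij : i ≤ j) :
    μ.real (f^[i] ⁻¹' A ∩ f^[j] ⁻¹' B) = μ.real (A ∩ f^[j - i] ⁻¹' B) := by
  rw [preimage_iterate_inter_preimage_iterate A B hij, (hf.iterate i).measureReal_preimage
    (hA.inter (hf.measurable.iterate _ hB)).nullMeasurableSet]

theorem sum_measureReal_preimage_inter_eq_returnSum (hf : MeasurePreserving f μ μ)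
    (hB : MeasurableSet B) (p : ℕ) :
    ∑ j ∈ Finset.range p, μ.real (f^[j] ⁻¹' B ∩ f^[p] ⁻¹' B) = returnSum f μ B p := by
  calc ∑ j ∈ Finset.range p, μ.real (f^[j] ⁻¹' B ∩ f^[p] ⁻¹' B)
      = ∑ j ∈ Finset.range p, μ.real (B ∩ f^[p - j] ⁻¹' B) :=
        Finset.sum_congr rfl fun j hj =>
          measureReal_preimage_iterate_inter hf hB hB (Finset.mem_range.1 hj).le
    _ = ∑ j ∈ Finset.range p, μ.real (B ∩ f^[j + 1] ⁻¹' B) := by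
        rw [← Finset.sum_range_reflect]
        refine Finset.sum_congr rfl fun j hj => ?_
        rw [show p - (p - 1 - j) = j + 1 by have := Finset.mem_range.1 hj; omega]
    _ = returnSum f μ B p := by
        rw [returnSum, Finset.range_eq_Ico, Finset.sum_Ico_add' (fun j => μ.real (B ∩ f^[j] ⁻¹' B))]
        rfl

theorem measureReal_preimage_inter_le_add_returnSum [IsFiniteMeasure μ]
    (hf : MeasurePreserving f μ μ)
    (hB : MeasurableSet B) (F : Set α) (p : ℕ) :
    μ.real (f^[p] ⁻¹' B ∩ F) ≤
      μ.real (avoidSet f B p ∩ F ∩ f^[p] ⁻¹' B) + returnSum f μ B p := by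
  have hcover : f^[p] ⁻¹' B ∩ F ⊆ (avoidSet f B p ∩ F ∩ f^[p] ⁻¹' B) ∪
      ⋃ j ∈ Finset.range p, f^[j] ⁻¹' B ∩ f^[p] ⁻¹' B := by
    rintro x ⟨hx, hxF⟩
    by_cases hxB : x ∈ avoidSet f B p
    · exact Or.inl ⟨⟨hxB, hxF⟩, hx⟩
    · simp only [avoidSet, Set.mem_ofPred_eq, not_forall, not_not] at hxB
      obtain ⟨j, hj, hjB⟩ := hxB
      exact Or.inr (Set.mem_biUnion (Finset.mem_coe.2 (Finset.mem_range.2 hj)) ⟨hjB, hx⟩)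
  rw [← sum_measureReal_preimage_inter_eq_returnSum hf hB]
  exact (measureReal_mono hcover).trans <| (measureReal_union_le _ _).trans <|
    add_le_add le_rfl (measureReal_biUnion_finset_le _ _)

theorem measureReal_avoidSet_inter_le [IsFiniteMeasure μ] (hf : MeasurePreserving f μ μ)
    (hB : MeasurableSet B) (F : Set α) {p P : ℕ} (hp : p ≤ P) :
    μ.real (avoidSet f B p ∩ F) ≤ μ.real F -
      ∑ j ∈ Finset.range p, μ.real (f^[j] ⁻¹' B ∩ F) + p * returnSum f μ B P := by
  induction p with
  | zero => simp [avoidSet_zero]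
  | succ p ih =>
    have hsplit : μ.real (avoidSet f B p ∩ F) = μ.real (avoidSet f B p ∩ F ∩ f^[p] ⁻¹' B) +
        μ.real (avoidSet f B (p + 1) ∩ F) := by
      rw [avoidSet_succ, ← Set.inter_sdiff_right_comm,
        measureReal_inter_add_sdiff (hf.measurable.iterate p hB)]
    have hhit := measureReal_preimage_inter_le_add_returnSum hf hB F p
    have hreturn := returnSum_mono (f := f) (μ := μ) (B := B) (Nat.le_of_succ_le hp)
    have ih := ih (Nat.le_of_succ_le hp)
    rw [Finset.sum_range_succ]
    push_cast
    linarith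

variable [IsProbabilityMeasure μ]

theorem measureReal_avoidSet_block_le (hf : MeasurePreserving f μ μ) (hB : MeasurableSet B)
    {D : ℝ} (hD : 0 ≤ D) {q : ℕ} (hmix : IsDecorrelated f μ D q B) (p n : ℕ) :
    μ.real (avoidSet f B (p + q + n)) ≤ Real.exp (-(p * μ.real B)) * μ.real (avoidSet f B n) +
      p * (D + returnSum f μ B p) := by
  set H := avoidSet f B n
  have hH : MeasurableSet H := measurableSet_avoidSet hf.measurable hB n
  have hblock : μ.real (avoidSet f B (p + q + n)) ≤ μ.real H -
      ∑ j ∈ Finset.range p, μ.real (f^[j] ⁻¹' B ∩ f^[p + q] ⁻¹' H) + p * returnSum f μ B p := by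
    rw [← (hf.iterate (p + q)).measureReal_preimage hH.nullMeasurableSet]
    exact (measureReal_mono (avoidSet_subset_inter_preimage f B (by omega) le_rfl)).trans
      (measureReal_avoidSet_inter_le hf hB _ le_rfl)
  have hsum : p * ((μ.real B - D) * μ.real H) ≤
      ∑ j ∈ Finset.range p, μ.real (f^[j] ⁻¹' B ∩ f^[p + q] ⁻¹' H) := by
    calc p * ((μ.real B - D) * μ.real H)
        = ∑ _j ∈ Finset.range p, (μ.real B - D) * μ.real H := by simp
      _ ≤ _ := by
        refine Finset.sum_le_sum fun j hj => ?_
        have hj := Finset.mem_range.1 hj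
        rw [measureReal_preimage_iterate_inter hf hB hH (by omega)]
        exact hmix.le_measureReal_inter hH (by omega)
  have hexp : (1 - p * μ.real B) * μ.real H ≤ Real.exp (-(p * μ.real B)) * μ.real H :=
    mul_le_mul_of_nonneg_right (Real.one_sub_le_exp_neg _) measureReal_nonneg
  have herror : p * D * μ.real H ≤ p * D :=
    mul_le_of_le_one_right (by positivity) measureReal_le_one
  linarith

/-- Cut the time interval into `M` blocks of length `p` separated by gaps of length `q`: the gaps
make the blocks almost independent, and each block is avoided with probability about
`exp (-p * μ B)`. -/
theorem measureReal_avoidSet_le (hf : MeasurePreserving f μ μ) (hB : MeasurableSet B)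
    {D : ℝ} (hD : 0 ≤ D) {q : ℕ} (hmix : IsDecorrelated f μ D q B) (p M : ℕ) :
    μ.real (avoidSet f B (M * (p + q))) ≤ Real.exp (-(M * p * μ.real B)) +
      M * p * (D + returnSum f μ B p) := by
  induction M with
  | zero => simp
  | succ M ih =>
    obtain ⟨E, hE⟩ : ∃ E, E = p * (D + returnSum f μ B p) := ⟨_, rfl⟩
    have hE0 : 0 ≤ E := hE ▸ mul_nonneg p.cast_nonneg (add_nonneg hD (returnSum_nonneg p))
    have hexp : Real.exp (-(p * μ.real B)) ≤ 1 :=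
      Real.exp_le_one_iff.2 (neg_nonpos.2 (by positivity))
    rw [mul_assoc (M : ℝ) p (D + _), ← hE] at ih
    calc μ.real (avoidSet f B ((M + 1) * (p + q)))
        ≤ Real.exp (-(p * μ.real B)) * μ.real (avoidSet f B (M * (p + q))) + E := by
          rw [show (M + 1) * (p + q) = p + q + M * (p + q) by ring, hE]
          exact measureReal_avoidSet_block_le hf hB hD hmix p _
      _ ≤ Real.exp (-(p * μ.real B)) * (Real.exp (-(M * p * μ.real B)) + M * E) + E := by gcongr
      _ ≤ Real.exp (-(p * μ.real B)) * Real.exp (-(M * p * μ.real B)) + M * E + E := by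
          rw [mul_add]
          exact add_le_add_left (add_le_add_right
            (mul_le_of_le_one_left (mul_nonneg M.cast_nonneg hE0) hexp) _) _
      _ = Real.exp (-((M + 1 : ℕ) * p * μ.real B)) +
            (M + 1 : ℕ) * p * (D + returnSum f μ B p) := by
          rw [← Real.exp_add, hE]
          push_cast
          ring_nf

end Avoidance

/-! ### The probability of not returning close to the starting point -/

section NoReturn

variable {α ι : Type*} [PseudoMetricSpace α] {f : α → α} {r δ : ℝ}

/-- The points that do not return to within distance less than `r` at any time `1 ≤ j ≤ n`. -/
def noReturnSet (f : α → α) (n : ℕ) (r : ℝ) : Set α :=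
  {x | ∀ j ∈ Set.Icc 1 n, r ≤ dist (f^[j] x) x}

theorem noReturnSet_inter_subset {I : Set α} {z : α} (hI : I ⊆ Metric.ball z δ) {m n q : ℕ}
    (hq : 1 ≤ q) (hn : q + m ≤ n + 1) :
    noReturnSet f n r ∩ I ⊆ I ∩ f^[q] ⁻¹' avoidSet f (Metric.closedBall z (r - δ)) m := by
  rintro x ⟨hx, hxI⟩
  refine ⟨hxI, fun j hj hjB => ?_⟩
  rw [← Function.iterate_add_apply, Metric.mem_closedBall] at hjB
  have hfar := hx (j + q) ⟨by omega, by omega⟩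
  have hnear := Metric.mem_ball.1 (hI hxI)
  linarith [dist_triangle_right (f^[j + q] x) x z]

variable [MeasurableSpace α] {μ : Measure α}

/-- The measurable sets `I i`, `i ∈ s`, are disjoint, cover almost every point, and each `I i` lies
in the ball of radius `δ` around `z i`. -/
structure IsFinePartition (μ : Measure α) (s : Finset ι) (I : ι → Set α) (z : ι → α) (δ : ℝ) :
    Prop where
  measurableSet : ∀ i ∈ s, MeasurableSet (I i)
  pairwiseDisjoint : (s : Set ι).PairwiseDisjoint I
  subset_ball : ∀ i ∈ s, I i ⊆ Metric.ball (z i) δ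
  ae_mem : ∀ᵐ x ∂μ, x ∈ ⋃ i ∈ s, I i

namespace IsFinePartition

variable {s : Finset ι} {I : ι → Set α} {z : ι → α}

theorem measure_le_sum (h : IsFinePartition μ s I z δ) (A : Set α) :
    μ A ≤ ∑ i ∈ s, μ (A ∩ I i) := by
  refine (measure_mono_ae ?_).trans (measure_biUnion_finset_le s fun i => A ∩ I i)
  filter_upwards [h.ae_mem] with x hx hxA
  rw [← Set.inter_iUnion₂]
  exact ⟨hxA, hx⟩

theorem sum_measureReal_le [IsFiniteMeasure μ] (h : IsFinePartition μ s I z δ) {t : Finset ι}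
    (hts : t ⊆ s) {A : Set α} (hA : ∀ i ∈ t, I i ⊆ A) : ∑ i ∈ t, μ.real (I i) ≤ μ.real A := by
  rw [← measureReal_biUnion_finset (h.pairwiseDisjoint.subset (Finset.coe_subset.2 hts))
    fun i hi => h.measurableSet i (hts hi)]
  exact measureReal_mono (Set.iUnion₂_subset hA)

theorem sum_measureReal_mul_indicator_le [IsFiniteMeasure μ] (h : IsFinePartition μ s I z δ)
    (r : ℝ) (x : α) :
    ∑ i ∈ s, μ.real (I i) * (Metric.closedBall (z i) (r - δ)).indicator 1 x ≤
      μ.real (Metric.closedBall x r) := by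
  classical
  calc ∑ i ∈ s, μ.real (I i) * (Metric.closedBall (z i) (r - δ)).indicator 1 x
      = ∑ i ∈ s with x ∈ Metric.closedBall (z i) (r - δ), μ.real (I i) := by
        simp [Finset.sum_filter, Set.indicator_apply]
    _ ≤ μ.real (Metric.closedBall x r) := by
        refine h.sum_measureReal_le (Finset.filter_subset _ s) fun i hi y hy => ?_
        obtain ⟨his, hix⟩ := Finset.mem_filter.1 hi
        have hiy := Metric.mem_ball.1 (h.subset_ball i his hy)
        rw [Metric.mem_closedBall] at hix ⊢
        linarith [dist_triangle_right y x (z i)]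

/-- A point of `B i` whose `j`-th iterate is in `B i` has returned to within twice the radius of
`B i`, and only the pieces of the partition close to that point contribute to the average. -/
theorem sum_measureReal_mul_self_return_le [SecondCountableTopology α] [OpensMeasurableSpace α]
    [IsFiniteMeasure μ] (h : IsFinePartition μ s I z δ) (hf : Measurable f) (hδ : 0 ≤ δ) {V : ℝ}
    (hV : ∀ x, μ.real (Metric.closedBall x r) ≤ V) (j : ℕ) :
    ∑ i ∈ s, μ.real (I i) * μ.real (Metric.closedBall (z i) (r - δ) ∩
        f^[j] ⁻¹' Metric.closedBall (z i) (r - δ)) ≤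
      V * μ.real {x | dist x (f^[j] x) ≤ 2 * r} := by
  set B : ι → Set α := fun i => Metric.closedBall (z i) (r - δ)
  set E : Set α := {x | dist x (f^[j] x) ≤ 2 * r}
  have hB : ∀ i, MeasurableSet (B i ∩ f^[j] ⁻¹' B i) := fun i =>
    measurableSet_closedBall.inter (hf.iterate j measurableSet_closedBall)
  have hE : MeasurableSet E :=
    measurableSet_le (measurable_id.dist (hf.iterate j)) measurable_const
  have hint : ∀ A : Set α, MeasurableSet A → ∀ c : ℝ,
      Integrable (fun x => c * A.indicator 1 x) μ := fun A hA c =>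
    ((integrable_const (1 : ℝ)).indicator hA).const_mul c
  have hintegral : ∀ A : Set α, MeasurableSet A → ∀ c : ℝ,
      c * μ.real A = ∫ x, c * A.indicator 1 x ∂μ := fun A hA c => by
    rw [integral_const_mul, integral_indicator_one hA]
  rw [hintegral E hE, Finset.sum_congr rfl fun i _ => hintegral _ (hB i) _,
    ← integral_finsetSum _ fun i _ => hint _ (hB i) _]
  refine integral_mono (integrable_finsetSum _ fun i _ => hint _ (hB i) _) (hint E hE V)
    fun x => ?_
  by_cases hxE : x ∈ E
  · rw [Set.indicator_of_mem hxE, Pi.one_apply, mul_one]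
    refine (Finset.sum_le_sum fun i _ => ?_).trans
      ((h.sum_measureReal_mul_indicator_le r x).trans (hV x))
    gcongr
    · exact zero_le_one
    · exact Set.inter_subset_left
  · have hxB : ∀ i, x ∉ B i ∩ f^[j] ⁻¹' B i := fun i ⟨hx, hfx⟩ => hxE <|
      (dist_triangle_right x (f^[j] x) (z i)).trans <| by
        linarith [Metric.mem_closedBall.1 hx, Metric.mem_closedBall.1 hfx]
    simp [hxE, hxB]

theorem sum_measureReal_mul_returnSum_le [SecondCountableTopology α] [OpensMeasurableSpace α]
    [IsFiniteMeasure μ] (h : IsFinePartition μ s I z δ) (hf : Measurable f) (hδ : 0 ≤ δ) {V : ℝ}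
    (hV : ∀ x, μ.real (Metric.closedBall x r) ≤ V) (p : ℕ) :
    ∑ i ∈ s, μ.real (I i) * returnSum f μ (Metric.closedBall (z i) (r - δ)) p ≤
      V * ∑ j ∈ Finset.Icc 1 p, μ.real {x | dist x (f^[j] x) ≤ 2 * r} := by
  simp only [returnSum, Finset.mul_sum]
  rw [Finset.sum_comm]
  exact Finset.sum_le_sum fun j _ => h.sum_measureReal_mul_self_return_le hf hδ hV j

theorem sum_ofReal_measureReal_mul_exp_le [IsFiniteMeasure μ] (h : IsFinePartition μ s I z δ)
    {a : ℝ} (ha : 0 ≤ a) (r : ℝ) :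
    ∑ i ∈ s, ENNReal.ofReal (μ.real (I i) *
        Real.exp (-(a * μ.real (Metric.closedBall (z i) (r - δ))))) ≤
      ∫⁻ y, ENNReal.ofReal (Real.exp (-(a * μ.real (Metric.closedBall y (r - 2 * δ))))) ∂μ := by
  refine le_trans (Finset.sum_le_sum fun i hi => ?_)
    ((lintegral_biUnion_finset h.pairwiseDisjoint h.measurableSet _).symm.trans_le
      (setLIntegral_le_lintegral _ _))
  rw [ENNReal.ofReal_mul measureReal_nonneg, ofReal_measureReal, mul_comm, ← setLIntegral_const]
  refine setLIntegral_mono' (h.measurableSet i hi) fun y hy => ?_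
  have hball : Metric.closedBall y (r - 2 * δ) ⊆ Metric.closedBall (z i) (r - δ) :=
    Metric.closedBall_subset_closedBall' <| by
      linarith [Metric.mem_ball.1 (h.subset_ball i hi hy)]
  have hle := measureReal_mono (μ := μ) hball
  gcongr

end IsFinePartition

variable [OpensMeasurableSpace α] [IsProbabilityMeasure μ] {D : ℝ} {p q M n : ℕ}

theorem measureReal_noReturnSet_inter_le (hf : MeasurePreserving f μ μ) {I : Set α} {z : α}
    (hI : I ⊆ Metric.ball z δ) (hD : 0 ≤ D) (hq : 1 ≤ q) (hmixI : IsDecorrelated f μ D q I)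
    (hmixB : IsDecorrelated f μ D q (Metric.closedBall z (r - δ)))
    (hn : q + M * (p + q) ≤ n + 1) :
    μ.real (noReturnSet f n r ∩ I) ≤
      μ.real I * Real.exp (-(M * p * μ.real (Metric.closedBall z (r - δ)))) +
      (M * p * (μ.real I * D + μ.real I * returnSum f μ (Metric.closedBall z (r - δ)) p) + D) := by
  set F := avoidSet f (Metric.closedBall z (r - δ)) (M * (p + q))
  have hF : MeasurableSet F := measurableSet_avoidSet hf.measurable measurableSet_closedBall _
  have hDF : D * μ.real F ≤ D := mul_le_of_le_one_right hD measureReal_le_one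
  have hIF := mul_le_mul_of_nonneg_left
    (measureReal_avoidSet_le hf measurableSet_closedBall hD hmixB p M)
    (measureReal_nonneg (μ := μ) (s := I))
  calc μ.real (noReturnSet f n r ∩ I) ≤ μ.real (I ∩ f^[q] ⁻¹' F) :=
        measureReal_mono (noReturnSet_inter_subset hI hq hn)
    _ ≤ (μ.real I + D) * μ.real F := hmixI.measureReal_inter_le hF le_rfl
    _ ≤ _ := by linarith

theorem IsFinePartition.measure_noReturnSet_le [SecondCountableTopology α] {s : Finset ι}
    {I : ι → Set α} {z : ι → α} (h : IsFinePartition μ s I z δ) (hf : MeasurePreserving f μ μ)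
    (hδ : 0 ≤ δ) {V : ℝ} (hV : ∀ x, μ.real (Metric.closedBall x r) ≤ V)
    (hD : 0 ≤ D) (hq : 1 ≤ q) (hmixI : ∀ i ∈ s, IsDecorrelated f μ D q (I i))
    (hmixB : ∀ i ∈ s, IsDecorrelated f μ D q (Metric.closedBall (z i) (r - δ)))
    (hn : q + M * (p + q) ≤ n + 1) :
    μ (noReturnSet f n r) ≤
      ∫⁻ y, ENNReal.ofReal
        (Real.exp (-(M * p * μ.real (Metric.closedBall y (r - 2 * δ))))) ∂μ +
      ENNReal.ofReal (M * p * (D + V * ∑ j ∈ Finset.Icc 1 p,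
        μ.real {x | dist x (f^[j] x) ≤ 2 * r}) + s.card * D) := by
  set main : ι → ℝ := fun i =>
    μ.real (I i) * Real.exp (-(M * p * μ.real (Metric.closedBall (z i) (r - δ))))
  set error : ι → ℝ := fun i => M * p * (μ.real (I i) * D +
    μ.real (I i) * returnSum f μ (Metric.closedBall (z i) (r - δ)) p) + D
  have herror_nonneg : ∀ i, 0 ≤ error i := fun i => by
    have := returnSum_nonneg (f := f) (μ := μ) (B := Metric.closedBall (z i) (r - δ)) p
    positivity
  have herror : ∑ i ∈ s, error i ≤ M * p * (D + V * ∑ j ∈ Finset.Icc 1 p,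
      μ.real {x | dist x (f^[j] x) ≤ 2 * r}) + s.card * D := by
    have htotal : (∑ i ∈ s, μ.real (I i)) * D ≤ D := mul_le_of_le_one_left hD <|
      (h.sum_measureReal_le subset_rfl fun i _ => Set.subset_univ (I i)).trans measureReal_le_one
    have hreturn := h.sum_measureReal_mul_returnSum_le hf.measurable hδ hV p
    simp only [error, Finset.sum_add_distrib, ← Finset.mul_sum, ← Finset.sum_mul, Finset.sum_const,
      nsmul_eq_mul]
    gcongr
  calc μ (noReturnSet f n r) ≤ ∑ i ∈ s, μ (noReturnSet f n r ∩ I i) := h.measure_le_sum _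
    _ ≤ ∑ i ∈ s, (ENNReal.ofReal (main i) + ENNReal.ofReal (error i)) := by
        refine Finset.sum_le_sum fun i hi => ?_
        rw [← ENNReal.ofReal_add (by positivity) (herror_nonneg i), ← ofReal_measureReal]
        exact ENNReal.ofReal_le_ofReal <| measureReal_noReturnSet_inter_le hf
          (h.subset_ball i hi) hD hq (hmixI i hi) (hmixB i hi) hn
    _ ≤ _ := by
        rw [Finset.sum_add_distrib, ← ENNReal.ofReal_sum_of_nonneg fun i _ => herror_nonneg i]
        exact add_le_add (h.sum_ofReal_measureReal_mul_exp_le (by positivity) r)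
          (ENNReal.ofReal_le_ofReal herror)

end NoReturn

/-! ### Partition of the line into cells -/

/-- The half-open interval `[iδ, (i+1)δ)`. -/
def cell (δ : ℝ) (i : ℤ) : Set ℝ := Set.Ico (i * δ) ((i + 1) * δ)

theorem ordConnected_cell (δ : ℝ) (i : ℤ) : (cell δ i).OrdConnected := Set.ordConnected_Ico

theorem measurableSet_cell (δ : ℝ) (i : ℤ) : MeasurableSet (cell δ i) := measurableSet_Ico

theorem pairwise_disjoint_cell (δ : ℝ) : Pairwise (Function.onFun Disjoint (cell δ)) := by
  have h := Set.pairwise_disjoint_Ico_zsmul δ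
  simp only [zsmul_eq_mul, Int.cast_add, Int.cast_one] at h
  exact h

theorem mem_cell_iff {δ : ℝ} (hδ : 0 < δ) {i : ℤ} {x : ℝ} : x ∈ cell δ i ↔ ⌊x / δ⌋ = i := by
  rw [cell, Set.mem_Ico, Int.floor_eq_iff, le_div_iff₀ hδ, div_lt_iff₀ hδ]

theorem cell_subset_ball (δ : ℝ) (i : ℤ) : cell δ i ⊆ Metric.ball (i * δ) δ := fun x hx => by
  rw [Metric.mem_ball, Real.dist_eq, abs_of_nonneg (sub_nonneg.2 hx.1)]
  linarith [hx.2]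

theorem exists_isFinePartition_cell {μ : Measure ℝ} {X : Set ℝ} (hXb : Bornology.IsBounded X)
    (hX : ∀ᵐ x ∂μ, x ∈ X) : ∃ Λ > (0 : ℝ), ∀ δ > (0 : ℝ), ∃ s : Finset ℤ,
      (s.card : ℝ) ≤ Λ / δ + 2 ∧ IsFinePartition μ s (cell δ) (fun i => i * δ) δ := by
  obtain ⟨R, hR, hXR⟩ := hXb.subset_closedBall_lt 0 0
  refine ⟨2 * R, by positivity, fun δ hδ => ⟨Finset.Icc ⌊-R / δ⌋ ⌊R / δ⌋, ?_,
    fun i _ => measurableSet_cell δ i, (pairwise_disjoint_cell δ).set_pairwise _,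
    fun i _ => cell_subset_ball δ i, ?_⟩⟩
  · have hle : ⌊-R / δ⌋ ≤ ⌊R / δ⌋ + 1 :=
      (Int.floor_mono (by gcongr; linarith)).trans (Int.le_add_one le_rfl)
    have hcard : ((Finset.Icc ⌊-R / δ⌋ ⌊R / δ⌋).card : ℝ) = ⌊R / δ⌋ + 1 - ⌊-R / δ⌋ := by
      exact_mod_cast Int.card_Icc_of_le _ _ hle
    have hfloor := Int.floor_le (R / δ)
    have hfloor_neg := Int.lt_floor_add_one (-R / δ)
    have hdiff : 2 * R / δ = R / δ - -R / δ := by ring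
    linarith
  · filter_upwards [hX] with x hx
    obtain ⟨hx_ge, hx_le⟩ := Real.closedBall_eq_Icc ▸ hXR hx
    refine Set.mem_biUnion (Finset.mem_coe.2 (Finset.mem_Icc.2 ⟨?_, ?_⟩))
      ((mem_cell_iff hδ).2 rfl) <;>
    · refine Int.floor_mono (div_le_div_of_nonneg_right ?_ hδ.le)
      linarith

/-! ### Asymptotic form of the no-return bound -/

theorem eventually_log_sq_le_rpow {a δ : ℝ} (ha : 0 < a) (hδ : 0 < δ) :
    ∀ᶠ n : ℕ in atTop, Real.log n ^ 2 ≤ δ * (n : ℝ) ^ a := by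
  filter_upwards [tendsto_natCast_atTop_atTop.eventually
    ((isLittleO_log_rpow_rpow_atTop 2 ha).bound hδ)] with n hn
  rw [Real.rpow_two, Real.norm_of_nonneg (Real.rpow_nonneg n.cast_nonneg a)] at hn
  exact (le_abs_self _).trans hn

theorem exists_block_count {p q n : ℕ} {ε : ℝ} (hε : 0 < ε) (hε1 : ε < 1) (hq : 1 ≤ q)
    (hqp : (q : ℝ) ≤ ε / 4 * p) (hpn : (p : ℝ) + 2 * q ≤ ε / 4 * n) :
    ∃ M : ℕ, q + M * (p + q) ≤ n + 1 ∧ (1 - ε) * n ≤ M * p ∧ (M * p : ℝ) ≤ n := by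
  have hqn : q ≤ n := by
    rify
    nlinarith [(n.cast_nonneg : (0 : ℝ) ≤ n), (p.cast_nonneg : (0 : ℝ) ≤ p)]
  obtain ⟨M, hM⟩ : ∃ M, M = (n + 1 - q) / (p + q) := ⟨_, rfl⟩
  have hfit : q + M * (p + q) ≤ n + 1 := by
    have := Nat.div_mul_le_self (n + 1 - q) (p + q)
    rw [← hM] at this
    omega
  have hmax : n + 1 ≤ (M + 1) * (p + q) + q := by
    have := Nat.lt_div_mul_add (a := n + 1 - q) (show 0 < p + q by omega)
    rw [← hM] at this
    linarith [Nat.sub_add_cancel (hqn.trans n.le_succ)]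
  refine ⟨M, hfit, ?_, ?_⟩
  all_goals rify at hfit hmax hq
  · have hgaps : (M : ℝ) * q ≤ ε / 4 * (M * p) := by nlinarith [(M.cast_nonneg : (0 : ℝ) ≤ M)]
    have hfill : (1 - ε / 4) * n ≤ (1 + ε / 4) * (M * p) := by linarith
    refine le_of_mul_le_mul_left (hfill.trans' ?_) (by positivity : 0 < 1 + ε / 4)
    nlinarith [mul_nonneg (mul_pos hε hε).le (n.cast_nonneg : (0 : ℝ) ≤ n),
      mul_nonneg hε.le (n.cast_nonneg : (0 : ℝ) ≤ n)]
  · nlinarith [mul_nonneg (M.cast_nonneg : (0 : ℝ) ≤ M) (q.cast_nonneg : (0 : ℝ) ≤ q)]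

/-- Gaps of logarithmic length between blocks of squared logarithmic length leave almost all of
`{1, …, n}` to the blocks. -/
theorem eventually_exists_blocks {K ε : ℝ} (hK : 0 < K) (hε : 0 < ε) (hε1 : ε < 1) :
    ∀ᶠ n : ℕ in atTop, ∃ p q M : ℕ, (p : ℝ) ≤ Real.log n ^ 2 ∧ K * Real.log n ≤ q ∧ 1 ≤ q ∧
      q + M * (p + q) ≤ n + 1 ∧ (1 - ε) * n ≤ M * p ∧ (M * p : ℝ) ≤ n := by
  have hlog : Tendsto (fun n : ℕ => Real.log n) atTop atTop :=
    Real.tendsto_log_atTop.comp tendsto_natCast_atTop_atTop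
  filter_upwards [hlog.eventually_ge_atTop 2, hlog.eventually_ge_atTop ((K + 3) / (ε / 4)),
    eventually_log_sq_le_rpow one_pos (show (0 : ℝ) < ε / 4 / (2 * K + 5) by positivity)]
    with n hL hLε hLn
  generalize Real.log n = L at hL hLε hLn
  have hp : (⌊L ^ 2⌋₊ : ℝ) ≤ L ^ 2 := Nat.floor_le (sq_nonneg L)
  have hp' : L ^ 2 < ⌊L ^ 2⌋₊ + 1 := Nat.lt_floor_add_one _
  have hq : K * L ≤ (⌈K * L⌉₊ + 1 : ℕ) := (Nat.le_ceil _).trans (by simp)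
  have hq' : ((⌈K * L⌉₊ + 1 : ℕ) : ℝ) ≤ K * L + 2 := by
    push_cast
    linarith [Nat.ceil_lt_add_one (show 0 ≤ K * L by positivity)]
  rw [div_le_iff₀ (by positivity)] at hLε
  rw [Real.rpow_one, div_mul_eq_mul_div, le_div_iff₀ (by positivity)] at hLn
  obtain ⟨M, hM⟩ := exists_block_count (p := ⌊L ^ 2⌋₊) (q := ⌈K * L⌉₊ + 1) (n := n) hε hε1
    (Nat.le_add_left 1 _) (by nlinarith) (by nlinarith)
  exact ⟨_, _, M, hp, hq, Nat.le_add_left 1 _, hM⟩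

section

variable {X : Set ℝ} {f : ℝ → ℝ} {μ : Measure ℝ}

theorem ShortRecurrenceBound.exists_measureReal_le (h : ShortRecurrenceBound X f μ) :
    ∃ β ∈ Set.Ioo (0 : ℝ) 1, ∃ C > (0 : ℝ), ∀ᶠ n : ℕ in atTop, ∀ j : ℕ, 1 ≤ j →
      (j : ℝ) ≤ Real.log n ^ 2 →
      μ.real (closeReturnSet X f j ((n : ℝ) ^ (-(1 / 2) : ℝ))) ≤ C * (n : ℝ) ^ (-(β / 2)) := by
  have hcomp : Comparable (fun n : ℕ => (n : ℝ) ^ (-(1 / 2) : ℝ))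
      (fun n : ℕ => (n : ℝ) ^ (-(1 / 2) : ℝ)) := by
    refine ⟨2, one_lt_two, ?_⟩
    filter_upwards [eventually_ge_atTop 1] with n hn
    have hn : (0 : ℝ) < n := by exact_mod_cast hn
    rw [div_self (Real.rpow_pos_of_pos hn _).ne']
    norm_num
  obtain ⟨β, hβ, C, hC, hbound⟩ := h (1 / 2) (by norm_num) _ hcomp
  refine ⟨β, hβ, C, hC, hbound.mono fun n hn j hj hjn => (hn j hj hjn).trans_eq ?_⟩
  rw [← Real.rpow_mul n.cast_nonneg]
  ring_nf

theorem ShortRecurrenceBound.exists_sum_measureReal_le [IsFiniteMeasure μ]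
    (h : ShortRecurrenceBound X f μ) (hX : ∀ᵐ x ∂μ, x ∈ X) :
    ∃ κ ∈ Set.Ioo (0 : ℝ) 1, ∃ C > (0 : ℝ), ∀ᶠ n : ℕ in atTop, ∀ (p : ℕ) (r : ℝ),
      (p : ℝ) ≤ Real.log n ^ 2 → r ≤ (n : ℝ) ^ κ / n →
      ∑ j ∈ Finset.Icc 1 p, μ.real {x | dist x (f^[j] x) ≤ 2 * r} ≤ C / ((n : ℝ) ^ κ) ^ 3 := by
  obtain ⟨β, ⟨hβ0, hβ1⟩, C, hC, hbound⟩ := h.exists_measureReal_le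
  refine ⟨β / 8, ⟨by linarith, by linarith⟩, C, hC, ?_⟩
  have hgap : Tendsto (fun n : ℕ => (n : ℝ) ^ (1 / 2 - β / 8)) atTop atTop :=
    (tendsto_rpow_atTop (by linarith)).comp tendsto_natCast_atTop_atTop
  filter_upwards [hbound, hgap.eventually_ge_atTop 2, eventually_ge_atTop 1,
    eventually_log_sq_le_rpow (show 0 < β / 8 by positivity) one_pos]
    with n hn hgap hn1 hlog p r hp hr
  have hn0 : (0 : ℝ) < n := by exact_mod_cast hn1
  have : 0 < (n : ℝ) ^ (β / 8) := Real.rpow_pos_of_pos hn0 _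
  have hradius : 2 * r ≤ (n : ℝ) ^ (-(1 / 2) : ℝ) := by
    calc 2 * r ≤ 2 * ((n : ℝ) ^ (β / 8) / n) := by gcongr
      _ ≤ (n : ℝ) ^ (1 / 2 - β / 8) * ((n : ℝ) ^ (β / 8) / n) := by gcongr
      _ = (n : ℝ) ^ (-(1 / 2) : ℝ) := by
        rw [← mul_div_assoc, ← Real.rpow_add hn0, ← Real.rpow_sub_one hn0.ne']
        ring_nf
  have hterm : ∀ j ∈ Finset.Icc 1 p,
      μ.real {x | dist x (f^[j] x) ≤ 2 * r} ≤ C / ((n : ℝ) ^ (β / 8)) ^ 4 := fun j hj => by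
    obtain ⟨hj1, hjp⟩ := Finset.mem_Icc.1 hj
    have hsub : {x | dist x (f^[j] x) ≤ 2 * r} ≤ᵐ[μ]
        closeReturnSet X f j ((n : ℝ) ^ (-(1 / 2) : ℝ)) := by
      filter_upwards [hX] with x hx hxr
      exact ⟨hx, le_trans hxr hradius⟩
    calc _ ≤ C * (n : ℝ) ^ (-(β / 2)) := (ENNReal.toReal_mono (measure_ne_top _ _)
          (measure_mono_ae hsub)).trans
          (hn j hj1 ((Nat.cast_le.2 hjp).trans hp))
      _ = C / ((n : ℝ) ^ (β / 8)) ^ 4 := by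
          rw [← Real.rpow_mul_natCast hn0.le, Real.rpow_neg hn0.le, div_eq_mul_inv]
          ring_nf
  calc _ ≤ ∑ _j ∈ Finset.Icc 1 p, C / ((n : ℝ) ^ (β / 8)) ^ 4 := Finset.sum_le_sum hterm
    _ = p * (C / ((n : ℝ) ^ (β / 8)) ^ 4) := by simp
    _ ≤ (n : ℝ) ^ (β / 8) * (C / ((n : ℝ) ^ (β / 8)) ^ 4) := by gcongr; linarith
    _ = C / ((n : ℝ) ^ (β / 8)) ^ 3 := by field_simp

end

theorem mul_exp_neg_mul_le_div_pow {C c q n : ℝ} {k : ℕ} (hC : 0 ≤ C) (hc : 0 < c) (hn : 0 < n)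
    (hq : k / c * Real.log n ≤ q) : C * Real.exp (-c * q) ≤ C / n ^ k := by
  rw [div_eq_mul_inv, ← Real.exp_log (pow_pos hn k), Real.log_pow, ← Real.exp_neg]
  gcongr
  rw [div_mul_eq_mul_div, div_le_iff₀ hc] at hq
  linarith

theorem add_error_terms_le {n x a r D T S C₁ C₂ Λ N : ℝ} (hx : 1 ≤ x) (hxn : x ≤ n) (hD0 : 0 ≤ D)
    (hr0 : 0 ≤ r) (hT0 : 0 ≤ T) (hS : 0 ≤ S) (hN0 : 0 ≤ N) (ha : a ≤ n) (hD : D ≤ C₁ / n ^ 4)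
    (hr : r ≤ x / n) (hT : T ≤ C₂ / x ^ 3) (hN : N ≤ Λ * n ^ 2) :
    a * (D + S * (2 * r) * T) + N * D ≤ (C₁ + 2 * S * C₂ + Λ * C₁) / x := by
  have : 0 < x := by linarith
  have hn0 : 0 < n := by linarith
  have hn1 : 1 ≤ n := hx.trans hxn
  have hC₁ : 0 ≤ C₁ := by simpa using (le_div_iff₀ (by positivity)).1 (hD0.trans hD)
  have hC₂ : 0 ≤ C₂ := by simpa using (le_div_iff₀ (by positivity)).1 (hT0.trans hT)
  have hΛ : 0 ≤ Λ := nonneg_of_mul_nonneg_left (hN0.trans hN) (by positivity)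
  have hx_le_cube : x ≤ n ^ 3 := hxn.trans (le_self_pow₀ hn1 (by norm_num))
  have hx_le_sq : x ≤ n ^ 2 := hxn.trans (le_self_pow₀ hn1 (by norm_num))
  calc a * (D + S * (2 * r) * T) + N * D
      ≤ n * (C₁ / n ^ 4 + S * (2 * (x / n)) * (C₂ / x ^ 3)) + Λ * n ^ 2 * (C₁ / n ^ 4) := by gcongr
    _ = C₁ / n ^ 3 + 2 * S * C₂ / x ^ 2 + Λ * C₁ / n ^ 2 := by field_simp
    _ ≤ C₁ / x + 2 * S * C₂ / x + Λ * C₁ / x := by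
        gcongr
        exact le_self_pow₀ hx (by norm_num)
    _ = (C₁ + 2 * S * C₂ + Λ * C₁) / x := by ring

section

variable {X : Set ℝ} {f : ℝ → ℝ} {μ : Measure ℝ} {S : NNReal}

theorem measureReal_closedBall_le (h : μ ≤ S • volume) {r : ℝ} (hr : 0 ≤ r) (x : ℝ) :
    μ.real (Metric.closedBall x r) ≤ S * (2 * r) := by
  refine ENNReal.toReal_le_of_le_ofReal (by positivity) ((h _).trans_eq ?_)
  rw [ENNReal.ofReal_mul S.coe_nonneg, ENNReal.ofReal_coe_nnreal, ← Real.volume_closedBall x]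
  rfl

theorem exists_measure_noReturnSet_le [IsProbabilityMeasure μ] (hf : MeasurePreserving f μ μ)
    (hXb : Bornology.IsBounded X) (hX : ∀ᵐ x ∂μ, x ∈ X) (hdec : ExpDecayOfCorrelations X f μ)
    (hshort : ShortRecurrenceBound X f μ) (hμ : μ ≤ S • volume) {ε : ℝ} (hε : 0 < ε)
    (hε1 : ε < 1) :
    ∃ κ ∈ Set.Ioo (0 : ℝ) 1, ∃ C > (0 : ℝ), ∀ᶠ n : ℕ in atTop, ∀ r : ℝ,
      ((n : ℝ) ^ 2)⁻¹ ≤ r → r ≤ (n : ℝ) ^ κ / n →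
      μ (noReturnSet f n r) ≤
        ∫⁻ y, ENNReal.ofReal (Real.exp (-((1 - ε) * n *
          μ.real (Metric.closedBall y ((1 - ε) * r))))) ∂μ + ENNReal.ofReal (C / (n : ℝ) ^ κ) := by
  obtain ⟨C₁, hC₁, c, hc, hmix⟩ := hdec.exists_isDecorrelated hf.measurable
  obtain ⟨κ, hκ, C₂, hC₂, hsum⟩ := hshort.exists_sum_measureReal_le hX
  obtain ⟨Λ, hΛ, hpartition⟩ := exists_isFinePartition_cell hXb hX
  refine ⟨κ, hκ, C₁ + 2 * S * C₂ + (2 * Λ / ε + 2) * C₁, by positivity, ?_⟩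
  filter_upwards [hsum, eventually_ge_atTop 1,
    eventually_exists_blocks (show (0 : ℝ) < (4 : ℕ) / c by positivity) hε hε1]
    with n hsum hn ⟨p, q, M, hp, hq, hq1, hfit, hMp, hMpn⟩ r hr hr'
  have hn1 : (1 : ℝ) ≤ n := by exact_mod_cast hn
  have hn0 : (0 : ℝ) < n := zero_lt_one.trans_le hn1
  have hr0 : 0 < r := hr.trans_lt' (by positivity)
  obtain ⟨s, hcard, hs⟩ := hpartition (ε / 2 * r) (by positivity)
  have hcard' : (s.card : ℝ) ≤ (2 * Λ / ε + 2) * (n : ℝ) ^ 2 := by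
    have hr_inv : r⁻¹ ≤ (n : ℝ) ^ 2 := inv_le_of_inv_le₀ (by positivity) hr
    calc (s.card : ℝ) ≤ 2 * Λ / ε * r⁻¹ + 2 := hcard.trans_eq (by field_simp)
      _ ≤ 2 * Λ / ε * (n : ℝ) ^ 2 + 2 * (n : ℝ) ^ 2 := by
        gcongr
        nlinarith
      _ = _ := by ring
  refine (hs.measure_noReturnSet_le hf (by positivity)
    (measureReal_closedBall_le hμ hr0.le) (by positivity) hq1
    (fun i _ => hmix q _ (ordConnected_cell _ i))
    (fun i _ => hmix q _ (Real.closedBall_eq_Icc ▸ Set.ordConnected_Icc)) hfit).trans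
    (add_le_add (lintegral_mono fun y => ?_) (ENNReal.ofReal_le_ofReal ?_))
  · have hradius : r - 2 * (ε / 2 * r) = (1 - ε) * r := by ring
    rw [hradius]
    gcongr
  · exact add_error_terms_le (Real.one_le_rpow hn1 hκ.1.le)
      (Real.rpow_le_self_of_one_le hn1 hκ.2.le) (by positivity) hr0.le
      (Finset.sum_nonneg fun _ _ => measureReal_nonneg) S.2 (by positivity) hMpn
      (mul_exp_neg_mul_le_div_pow hC₁.le hc hn0 hq) hr' (hsum p r hp hr') hcard'

end

/-! ### Sequences of polynomial order along geometric times -/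

/-- The sequence `g` is positive and of at most polynomial growth and decay: it lies between
`k ^ (-A)` and `k ^ A` for all large `k`, for some exponent `A`. -/
def IsPolynomiallyBounded (g : ℕ → ℝ) : Prop :=
  ∃ A : ℝ, ∀ᶠ k : ℕ in atTop, g k ∈ Set.Icc ((k : ℝ) ^ (-A)) ((k : ℝ) ^ A)

theorem isPolynomiallyBounded_const {c : ℝ} (hc : 0 < c) : IsPolynomiallyBounded fun _ => c := by
  refine ⟨1, ?_⟩
  filter_upwards [tendsto_natCast_atTop_atTop.eventually_ge_atTop c,
    tendsto_natCast_atTop_atTop.eventually_ge_atTop c⁻¹] with k hk hk'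
  rw [Real.rpow_neg_one, Real.rpow_one]
  exact ⟨inv_le_of_inv_le₀ hc hk', hk⟩

theorem isPolynomiallyBounded_natCast : IsPolynomiallyBounded fun k => (k : ℝ) := by
  refine ⟨1, (eventually_ge_atTop 1).mono fun k hk => ?_⟩
  have hk : (1 : ℝ) ≤ k := by exact_mod_cast hk
  rw [Real.rpow_neg_one, Real.rpow_one]
  exact ⟨(inv_le_one_of_one_le₀ hk).trans hk, le_rfl⟩

theorem isPolynomiallyBounded_log_natCast_mul {l : ℝ} (hl : 0 < l) :
    IsPolynomiallyBounded fun k => Real.log (k * l) := by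
  have hlog : Tendsto (fun k : ℕ => Real.log (k * l)) atTop atTop :=
    Real.tendsto_log_atTop.comp (tendsto_natCast_atTop_atTop.atTop_mul_const hl)
  refine ⟨2, ?_⟩
  filter_upwards [hlog.eventually_ge_atTop 1, eventually_ge_atTop 1,
    tendsto_natCast_atTop_atTop.eventually_ge_atTop l] with k hk hk1 hkl
  have hk1 : (1 : ℝ) ≤ k := by exact_mod_cast hk1
  refine ⟨(Real.rpow_le_one_of_one_le_of_nonpos hk1 (by norm_num)).trans hk, ?_⟩
  calc Real.log (k * l) ≤ k * l := Real.log_le_self (by positivity)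
    _ ≤ k * k := by gcongr
    _ = (k : ℝ) ^ (2 : ℝ) := by rw [Real.rpow_two, sq]

namespace IsPolynomiallyBounded

variable {g h : ℕ → ℝ}

theorem eventually_pos (hg : IsPolynomiallyBounded g) : ∀ᶠ k in atTop, 0 < g k := by
  obtain ⟨A, hA⟩ := hg
  filter_upwards [hA, eventually_gt_atTop 0] with k hk hk0
  exact hk.1.trans_lt' (Real.rpow_pos_of_pos (Nat.cast_pos.2 hk0) _)

theorem mul (hg : IsPolynomiallyBounded g) (hh : IsPolynomiallyBounded h) :
    IsPolynomiallyBounded fun k => g k * h k := by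
  obtain ⟨A, hA⟩ := id hg
  obtain ⟨B, hB⟩ := id hh
  refine ⟨A + B, ?_⟩
  filter_upwards [hA, hB, hg.eventually_pos, hh.eventually_pos, eventually_gt_atTop 0]
    with k hgk hhk hg0 hh0 hk
  have hk : (0 : ℝ) < k := Nat.cast_pos.2 hk
  rw [neg_add, Real.rpow_add hk, Real.rpow_add hk]
  exact ⟨mul_le_mul hgk.1 hhk.1 (by positivity) hg0.le,
    mul_le_mul hgk.2 hhk.2 hh0.le (by positivity)⟩

theorem rpow (hg : IsPolynomiallyBounded g) (p : ℝ) :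
    IsPolynomiallyBounded fun k => g k ^ p := by
  obtain ⟨A, hA⟩ := id hg
  refine ⟨A * |p|, ?_⟩
  filter_upwards [hA, hg.eventually_pos, eventually_gt_atTop 0] with k ⟨hgk, hgk'⟩ hg0 hk
  have hk : (0 : ℝ) < k := Nat.cast_pos.2 hk
  rcases le_total 0 p with hp | hp
  · rw [abs_of_nonneg hp, ← neg_mul, Real.rpow_mul hk.le, Real.rpow_mul hk.le]
    exact ⟨by gcongr, by gcongr⟩
  · rw [abs_of_nonpos hp, mul_neg, neg_neg, ← neg_mul, Real.rpow_mul hk.le, Real.rpow_mul hk.le]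
    exact ⟨Real.rpow_le_rpow_of_nonpos hg0 hgk' hp,
      Real.rpow_le_rpow_of_nonpos (by positivity) hgk hp⟩

theorem tendsto_div_pow (hg : IsPolynomiallyBounded g) {a : ℝ} (ha : 1 < a) :
    Tendsto (fun k => g k / a ^ k) atTop (𝓝 0) := by
  have : 0 < a := zero_lt_one.trans ha
  obtain ⟨A, hA⟩ := id hg
  refine squeeze_zero' (hg.eventually_pos.mono fun k hk => by positivity) (hA.mono fun k hk => ?_)
    ((tendsto_rpow_mul_exp_neg_mul_atTop_nhds_zero A _ (Real.log_pos ha)).comp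
      tendsto_natCast_atTop_atTop)
  rw [Function.comp_apply, neg_mul, Real.exp_neg, mul_comm (Real.log a),
    ← Real.log_pow, Real.exp_log (by positivity), ← div_eq_mul_inv]
  gcongr
  exact hk.2

theorem summable_div_pow (hg : IsPolynomiallyBounded g) {a : ℝ} (ha : 1 < a) :
    Summable fun k => g k / a ^ k := by
  have hb : 1 < √a := Real.lt_sqrt_of_sq_lt (by simpa using ha)
  have ha0 : 0 ≤ a := zero_le_one.trans ha.le
  refine summable_of_isBigO_nat
    (summable_geometric_of_lt_one (by positivity) (inv_lt_one_of_one_lt₀ hb)) ?_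
  refine (((hg.tendsto_div_pow hb).isBigO_one ℝ).mul
    (Asymptotics.isBigO_refl (fun k : ℕ => (√a)⁻¹ ^ k) atTop)).congr
      (fun k => ?_) fun k => one_mul _
  rw [inv_pow, ← div_eq_mul_inv, div_div, ← mul_pow, Real.mul_self_sqrt ha0]

end IsPolynomiallyBounded

theorem eventually_le_floor_pow {ε θ : ℝ} (hε : 0 < ε) (hθ : 1 < θ) :
    ∀ᶠ k : ℕ in atTop, (1 - ε) * θ ^ k ≤ ⌊θ ^ k⌋₊ := by
  filter_upwards [(tendsto_pow_atTop_atTop_of_one_lt hθ).eventually_ge_atTop ε⁻¹] with k hk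
  have hone := (inv_le_iff_one_le_mul₀' hε).1 hk
  linarith [Nat.lt_floor_add_one (θ ^ k)]

theorem eventually_rpow_pow_le_floor_pow_rpow {θ κ : ℝ} (hθ : 1 < θ) (hκ : 0 ≤ κ) :
    ∀ᶠ k : ℕ in atTop, (1 / 2) ^ κ * (θ ^ κ) ^ k ≤ (⌊θ ^ k⌋₊ : ℝ) ^ κ := by
  filter_upwards [eventually_le_floor_pow one_half_pos hθ] with k hk
  have hθ0 : 0 < θ := zero_lt_one.trans hθ
  rw [Real.rpow_pow_comm hθ0.le, ← Real.mul_rpow (by norm_num) (by positivity)]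
  gcongr
  linarith

theorem IsPolynomiallyBounded.eventually_div_pow_mem_Icc {g : ℕ → ℝ} (hg : IsPolynomiallyBounded g)
    {θ κ : ℝ} (hθ : 1 < θ) (hκ : κ ∈ Set.Ioo (0 : ℝ) 1) :
    ∀ᶠ k : ℕ in atTop, g k / θ ^ k ∈
      Set.Icc ((⌊θ ^ k⌋₊ : ℝ) ^ 2)⁻¹ ((⌊θ ^ k⌋₊ : ℝ) ^ κ / ⌊θ ^ k⌋₊) := by
  have hθ0 : 0 < θ := zero_lt_one.trans hθ
  filter_upwards [hg.eventually_pos, eventually_le_floor_pow one_half_pos hθ,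
    ((hg.rpow (-1)).tendsto_div_pow hθ).eventually_le_const (show (0 : ℝ) < 1 / 4 by norm_num),
    (hg.tendsto_div_pow (Real.one_lt_rpow hθ hκ.1)).eventually_le_const one_pos]
    with k hg0 hfloor hinv hle
  have hθk : 0 < θ ^ k := by positivity
  have hN : 0 < (⌊θ ^ k⌋₊ : ℝ) := hfloor.trans_lt' (by linarith)
  have hNθ : (⌊θ ^ k⌋₊ : ℝ) ≤ θ ^ k := Nat.floor_le hθk.le
  constructor
  · rw [Real.rpow_neg_one, div_le_iff₀ hθk, inv_le_iff_one_le_mul₀ hg0] at hinv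
    rw [inv_le_iff_one_le_mul₀ (by positivity), div_mul_eq_mul_div, le_div_iff₀ hθk]
    have hsq : (1 / 2 * θ ^ k) ^ 2 ≤ (⌊θ ^ k⌋₊ : ℝ) ^ 2 := by
      gcongr
      linarith
    calc 1 * θ ^ k ≤ 1 / 4 * θ ^ k * g k * θ ^ k := by gcongr
      _ = g k * (1 / 2 * θ ^ k) ^ 2 := by ring
      _ ≤ g k * (⌊θ ^ k⌋₊ : ℝ) ^ 2 := by gcongr
  · rw [div_le_one (by positivity), Real.rpow_pow_comm hθ0.le] at hle
    rw [← Real.rpow_sub_one hN.ne']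
    calc g k / θ ^ k ≤ (θ ^ k) ^ κ / θ ^ k := by gcongr
      _ = (θ ^ k) ^ (κ - 1) := (Real.rpow_sub_one hθk.ne' κ).symm
      _ ≤ _ := Real.rpow_le_rpow_of_nonpos hN hNθ (by linarith [hκ.2])

/-! ### Almost sure upper bounds -/

theorem ae_eventually_notMem_of_eventually_le {α : Type*} [MeasurableSpace α] {μ : Measure α}
    {s : ℕ → Set α} {u : ℕ → ENNReal} (hu : ∑' k, u k ≠ ⊤) (h : ∀ᶠ k in atTop, μ (s k) ≤ u k) :
    ∀ᵐ x ∂μ, ∀ᶠ k in atTop, x ∉ s k := by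
  obtain ⟨K, hK⟩ := eventually_atTop.1 h
  have htail : ∑' k, μ (s (k + K)) ≠ ⊤ := ne_top_of_le_ne_top hu <|
    (ENNReal.tsum_le_tsum fun k => hK _ (Nat.le_add_left K k)).trans
      (ENNReal.tsum_comp_le_tsum_of_injective (add_left_injective K) u)
  filter_upwards [ae_eventually_notMem htail] with x hx
  rwa [← map_add_atTop_eq_nat K]

theorem lintegral_le_lintegral_add_measure {α : Type*} [MeasurableSpace α] {μ : Measure α}
    {F G : α → ENNReal} {E : Set α} (hF : ∀ x, F x ≤ 1) (hFG : ∀ᵐ x ∂μ, x ∉ E → F x ≤ G x) :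
    ∫⁻ x, F x ∂μ ≤ ∫⁻ x, G x ∂μ + μ E := by
  have hE := measurableSet_toMeasurable μ E
  rw [← measure_toMeasurable E, ← lintegral_indicator_one hE,
    ← lintegral_add_right _ (measurable_one.indicator hE)]
  refine lintegral_mono_ae (hFG.mono fun x hx => ?_)
  by_cases hxE : x ∈ toMeasurable μ E
  · rw [Set.indicator_of_mem hxE]
    exact le_add_left (hF x)
  · exact le_add_right (hx fun h => hxE (subset_toMeasurable μ E h))

theorem measure_not_closedBall_subset_le {X : Set ℝ} {μ : Measure ℝ} {S : NNReal}
    (hXo : X.OrdConnected) (hXb : Bornology.IsBounded X) (hμ : μ ≤ S • volume) (R : ℝ) :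
    μ {y ∈ X | ¬ Metric.closedBall y R ⊆ X} ≤ S * (2 * ENNReal.ofReal R) := by
  have hsub : {y ∈ X | ¬ Metric.closedBall y R ⊆ X} ⊆
      Set.Icc (sInf X) (sInf X + R) ∪ Set.Icc (sSup X - R) (sSup X) := by
    rintro y ⟨hy, hball⟩
    contrapose! hball
    have hinf : sInf X ≤ y := csInf_le hXb.bddBelow hy
    have hsup : y ≤ sSup X := le_csSup hXb.bddAbove hy
    simp only [Set.mem_union, Set.mem_Icc, hinf, hsup, true_and, and_true, not_or, not_le] at hball
    obtain ⟨a, ha, hay⟩ := exists_lt_of_csInf_lt ⟨y, hy⟩ (lt_sub_iff_add_lt.2 hball.1)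
    obtain ⟨b, hb, hby⟩ := exists_lt_of_lt_csSup ⟨y, hy⟩ (lt_sub_iff_add_lt.1 hball.2)
    rw [Real.closedBall_eq_Icc]
    exact (Set.Icc_subset_Icc hay.le hby.le).trans (hXo.out ha hb)
  calc _ ≤ S * volume (Set.Icc (sInf X) (sInf X + R) ∪ Set.Icc (sSup X - R) (sSup X)) :=
        (measure_mono hsub).trans (hμ _)
    _ ≤ S * (2 * ENNReal.ofReal R) := by
        gcongr
        refine (measure_union_le _ _).trans_eq ?_
        rw [Real.volume_Icc, Real.volume_Icc, add_sub_cancel_left, sub_sub_cancel, two_mul]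

theorem minReturnDist_le {f : ℝ → ℝ} {n j : ℕ} (x : ℝ) (hj : j ∈ Set.Icc 1 n) :
    minReturnDist f n x ≤ dist (f^[j] x) x :=
  csInf_le ⟨0, Set.forall_mem_image.2 fun _ _ => dist_nonneg⟩ (Set.mem_image_of_mem _ hj)

theorem eventually_exists_pow_near {θ : ℝ} (hθ : 1 < θ) {P : ℕ → Prop}
    (hP : ∀ᶠ k in atTop, P k) :
    ∀ᶠ n : ℕ in atTop, ∃ k, P k ∧ θ ^ k ≤ n ∧ (n : ℝ) < θ ^ (k + 1) := by
  obtain ⟨K, hK⟩ := eventually_atTop.1 hP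
  filter_upwards [eventually_ge_atTop 1, tendsto_natCast_atTop_atTop.eventually_ge_atTop (θ ^ K)]
    with n hn hKn
  obtain ⟨k, hk, hk'⟩ := exists_nat_pow_near (Nat.one_le_cast.2 hn) hθ
  exact ⟨k, hK k (Nat.lt_succ_iff.1 ((pow_lt_pow_iff_right₀ hθ).1 (hKn.trans_lt hk'))), hk, hk'⟩

theorem ae_eventually_minReturnDist_lt {f : ℝ → ℝ} {μ : Measure ℝ} {θ : ℝ} (hθ : 1 < θ)
    {R r : ℕ → ℝ} (hR : ∀ᵐ x ∂μ, ∀ᶠ k in atTop, x ∉ noReturnSet f ⌊θ ^ k⌋₊ (R k))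
    (hRr : ∀ᶠ k : ℕ in atTop, ∀ n : ℕ, θ ^ k ≤ n → (n : ℝ) < θ ^ (k + 1) → R k ≤ r n) :
    ∀ᵐ x ∂μ, ∀ᶠ n in atTop, minReturnDist f n x < r n := by
  filter_upwards [hR] with x hx
  filter_upwards [eventually_exists_pow_near hθ (hx.and hRr)] with n ⟨k, ⟨hk, hkr⟩, hkn, hnk⟩
  simp only [noReturnSet, Set.mem_ofPred_eq, not_forall, not_le] at hk
  obtain ⟨j, ⟨hj1, hjk⟩, hj⟩ := hk
  exact (minReturnDist_le x ⟨hj1, hjk.trans (Nat.floor_le_of_le hkn)⟩).trans_lt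
    (hj.trans_le (hkr n hkn hnk))

section

variable {X : Set ℝ} {f : ℝ → ℝ} {μ : Measure ℝ} {S : NNReal}

/-- Each of the three losses of a factor `1 - ε` can be made harmless: the blocks do not fill
`{1, …, n}`, the radius shrinks by the size of the partition, and `θ ^ k` is not an integer. -/
theorem ae_eventually_notMem_noReturnSet [IsProbabilityMeasure μ] (hf : MeasurePreserving f μ μ)
    (hXo : X.OrdConnected) (hXb : Bornology.IsBounded X) (hX : ∀ᵐ x ∂μ, x ∈ X)
    (hdec : ExpDecayOfCorrelations X f μ) (hshort : ShortRecurrenceBound X f μ)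
    (hμ : μ ≤ S • volume) {ε θ : ℝ} (hε : 0 < ε) (hε1 : ε < 1) (hθ : 1 < θ) {g : ℕ → ℝ}
    (hg : IsPolynomiallyBounded g) {G : ℕ → ℝ → ℝ}
    (hG : ∀ᶠ k : ℕ in atTop, ∀ y ∈ X, Metric.closedBall y (g k / θ ^ k) ⊆ X → G k y ≤
      (1 - ε) * ((1 - ε) * θ ^ k) * μ.real (Metric.closedBall y ((1 - ε) * (g k / θ ^ k))))
    (hsum : ∑' k, ∫⁻ y, ENNReal.ofReal (Real.exp (-G k y)) ∂μ ≠ ⊤) :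
    ∀ᵐ x ∂μ, ∀ᶠ k in atTop, x ∉ noReturnSet f ⌊θ ^ k⌋₊ (g k / θ ^ k) := by
  obtain ⟨κ, hκ, C, hC, hbound⟩ :=
    exists_measure_noReturnSet_le hf hXb hX hdec hshort hμ hε hε1
  have hfloor : Tendsto (fun k : ℕ => ⌊θ ^ k⌋₊) atTop atTop :=
    tendsto_nat_floor_atTop.comp (tendsto_pow_atTop_atTop_of_one_lt hθ)
  have : 0 < θ := zero_lt_one.trans hθ
  have hboundary : ∑' k, (S : ENNReal) * (2 * ENNReal.ofReal (g k / θ ^ k)) ≠ ⊤ := by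
    rw [ENNReal.tsum_mul_left, ENNReal.tsum_mul_left]
    exact ENNReal.mul_ne_top ENNReal.coe_ne_top <| ENNReal.mul_ne_top ENNReal.ofNat_ne_top
      (hg.summable_div_pow hθ).tsum_ofReal_ne_top
  have herror : ∑' k : ℕ, ENNReal.ofReal (C / (1 / 2) ^ κ / (θ ^ κ) ^ k) ≠ ⊤ :=
    ((isPolynomiallyBounded_const (by positivity)).summable_div_pow
      (Real.one_lt_rpow hθ hκ.1)).tsum_ofReal_ne_top
  refine ae_eventually_notMem_of_eventually_le (u := fun k =>
    ∫⁻ y, ENNReal.ofReal (Real.exp (-G k y)) ∂μ + S * (2 * ENNReal.ofReal (g k / θ ^ k)) +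
      ENNReal.ofReal (C / (1 / 2) ^ κ / (θ ^ κ) ^ k)) ?_ ?_
  · rw [ENNReal.tsum_add, ENNReal.tsum_add]
    exact ENNReal.add_ne_top.2 ⟨ENNReal.add_ne_top.2 ⟨hsum, hboundary⟩, herror⟩
  filter_upwards [hfloor.eventually hbound, hg.eventually_div_pow_mem_Icc hθ hκ, hG,
    eventually_le_floor_pow hε hθ, eventually_rpow_pow_le_floor_pow_rpow hθ hκ.1.le]
    with k hbound hradius hG hN hNκ
  refine (hbound _ hradius.1 hradius.2).trans (add_le_add ?_ ?_)
  · refine (lintegral_le_lintegral_add_measure (fun y => ?_) ?_).trans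
      (add_le_add le_rfl (measure_not_closedBall_subset_le hXo hXb hμ (g k / θ ^ k)))
    · rw [ENNReal.ofReal_le_one, Real.exp_le_one_iff, neg_nonpos]
      have := sub_pos.2 hε1
      positivity
    · filter_upwards [hX] with y hy hball
      have hGy := hG y hy (by_contra fun h => hball ⟨hy, h⟩)
      have := sub_pos.2 hε1
      gcongr
      exact hGy.trans (by gcongr)
  · rw [div_div]
    gcongr

theorem mul_le_measureReal_closedBall [IsFiniteMeasure μ] {A : Set ℝ} {m : NNReal}
    (hm : m • volume.restrict A ≤ μ) {y r : ℝ} (hr : 0 ≤ r) (hA : Metric.closedBall y r ⊆ A) :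
    m * (2 * r) ≤ μ.real (Metric.closedBall y r) := by
  have hle := hm (Metric.closedBall y r)
  rw [Measure.smul_apply, Measure.restrict_apply measurableSet_closedBall,
    Set.inter_eq_left.2 hA, Real.volume_closedBall, ENNReal.smul_def, smul_eq_mul] at hle
  simpa [Measure.real, hr] using ENNReal.toReal_mono (measure_ne_top _ _) hle

theorem exists_one_lt_mul_one_sub_pow {a : ℝ} (ha : 1 < a) (n : ℕ) :
    ∃ ε ∈ Set.Ioo (0 : ℝ) 1, 1 < a * (1 - ε) ^ n := by
  have hcont : ContinuousAt (fun ε : ℝ => a * (1 - ε) ^ n) 0 := by fun_prop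
  have hnhds : ∀ᶠ ε : ℝ in 𝓝[>] 0, 1 < a * (1 - ε) ^ n :=
    (hcont.eventually (lt_mem_nhds (by simpa using ha))).filter_mono nhdsWithin_le_nhds
  have hIoo : ∀ᶠ ε : ℝ in 𝓝[>] 0, ε ∈ Set.Ioo (0 : ℝ) 1 := Ioo_mem_nhdsGT one_pos
  exact (hIoo.and hnhds).exists

theorem summable_exp_neg_mul_log {t l : ℝ} (ht : 1 < t) (hl : 0 < l) :
    Summable fun k : ℕ => Real.exp (-(t * Real.log (k * l))) := by
  refine ((Real.summable_nat_rpow.2 (neg_lt_neg ht)).mul_right (l ^ (-t))).congr_atTop ?_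
  filter_upwards [eventually_gt_atTop 0] with k hk
  have hk : (0 : ℝ) < k := Nat.cast_pos.2 hk
  rw [← Real.mul_rpow hk.le hl.le, Real.rpow_def_of_pos (by positivity), mul_neg, mul_comm t]

theorem eventually_le_log_log_div {c θ : ℝ} (hc : 0 < c) (hθ : 1 < θ) :
    ∀ᶠ k : ℕ in atTop, ∀ n : ℕ, θ ^ k ≤ n → (n : ℝ) < θ ^ (k + 1) →
      c * θ⁻¹ * Real.log (k * Real.log θ) / θ ^ k ≤ c * Real.log (Real.log n) / n := by
  have hlogθ : 0 < Real.log θ := Real.log_pos hθ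
  have : 0 < θ := zero_lt_one.trans hθ
  filter_upwards [(isPolynomiallyBounded_log_natCast_mul hlogθ).eventually_pos,
    eventually_gt_atTop 0] with k hlog hk n hkn hnk
  have : (0 : ℝ) < k := Nat.cast_pos.2 hk
  have hθk : 0 < θ ^ k := by positivity
  have hn : (0 : ℝ) < n := hθk.trans_le hkn
  have hlog_le : k * Real.log θ ≤ Real.log n := by
    rw [← Real.log_pow]
    exact Real.log_le_log hθk hkn
  calc c * θ⁻¹ * Real.log (k * Real.log θ) / θ ^ k
      = c * Real.log (k * Real.log θ) / θ ^ (k + 1) := by rw [pow_succ]; field_simp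
    _ ≤ c * Real.log (Real.log n) / n := by
        have := Real.log_le_log (by positivity) hlog_le
        have := hlog.le.trans this
        gcongr

/-- The factor `(1 - ε) ^ 4` collects the three losses in `ae_eventually_notMem_noReturnSet` and the
ratio `θ⁻¹ = 1 - ε` of consecutive geometric times. -/
theorem ae_eventually_minReturnDist_lt_of_smul_le [IsProbabilityMeasure μ]
    (hf : MeasurePreserving f μ μ) (hXo : X.OrdConnected) (hXb : Bornology.IsBounded X)
    (hX : ∀ᵐ x ∂μ, x ∈ X) (hdec : ExpDecayOfCorrelations X f μ)
    (hshort : ShortRecurrenceBound X f μ) (hμ : μ ≤ S • volume) {m : NNReal}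
    (hm : m • volume.restrict X ≤ μ) {c : ℝ} (hc : 1 < 2 * c * m) {r : ℕ → ℝ}
    (hr : ∀ᶠ n : ℕ in atTop, c * Real.log (Real.log n) / n < r n) :
    ∀ᵐ x ∂μ, ∀ᶠ n in atTop, minReturnDist f n x < r n := by
  obtain ⟨ε, ⟨hε, hε1⟩, hεc⟩ := exists_one_lt_mul_one_sub_pow hc 4
  have hc0 : 0 < c := by
    by_contra! hneg
    nlinarith [m.coe_nonneg]
  have hθ : 1 < (1 - ε)⁻¹ := one_lt_inv_iff₀.2 ⟨sub_pos.2 hε1, sub_lt_self 1 hε⟩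
  have hlogθ := Real.log_pos hθ
  have hg : IsPolynomiallyBounded fun k =>
      c * (1 - ε)⁻¹⁻¹ * Real.log (k * Real.log (1 - ε)⁻¹) :=
    (isPolynomiallyBounded_const (by positivity)).mul (isPolynomiallyBounded_log_natCast_mul hlogθ)
  have hreturn := ae_eventually_notMem_noReturnSet hf hXo hXb hX hdec hshort hμ hε hε1 hθ hg
    (G := fun k _ => 2 * c * m * (1 - ε) ^ 4 * Real.log (k * Real.log (1 - ε)⁻¹)) ?_ ?_
  · filter_upwards [ae_eventually_minReturnDist_lt hθ hreturn (eventually_le_log_log_div hc0 hθ)]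
      with x hx
    filter_upwards [hx, hr] with n hn hrn using hn.trans hrn
  · filter_upwards [hg.eventually_pos] with k hgk y _ hball
    have hε1 := sub_pos.2 hε1
    have hradius := div_pos hgk (pow_pos (zero_lt_one.trans hθ) k)
    have hshrink : (1 - ε) * (_ / (1 - ε)⁻¹ ^ k) ≤ _ / (1 - ε)⁻¹ ^ k :=
      mul_le_of_le_one_left hradius.le (sub_le_self 1 hε.le)
    have hmass := mul_le_measureReal_closedBall hm (mul_pos hε1 hradius).le
      ((Metric.closedBall_subset_closedBall hshrink).trans hball)
    refine le_trans (le_of_eq ?_) (mul_le_mul_of_nonneg_left hmass (by positivity))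
    field_simp
  · simp only [lintegral_const, measure_univ, mul_one]
    exact (summable_exp_neg_mul_log hεc hlogθ).tsum_ofReal_ne_top

end

section

variable {X : Set ℝ} {f : ℝ → ℝ} {μ : Measure ℝ} {ρ : ℝ → ℝ}

theorem min_rpow_le_rpow {a b x : ℝ} (γ : ℝ) (ha : 0 < a) (hx : x ∈ Set.Icc a b) :
    min (a ^ γ) (b ^ γ) ≤ x ^ γ := by
  rcases le_total 0 γ with hγ | hγ
  · exact (min_le_left _ _).trans (Real.rpow_le_rpow ha.le hx.1 hγ)
  · exact (min_le_right _ _).trans (Real.rpow_le_rpow_of_nonpos (ha.trans_le hx.1) hx.2 hγ)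

theorem exists_le_log_rpow_div {γ γ₀ : ℝ} (hγ : γ₀ ≤ γ) :
    ∃ m > (0 : ℝ), ∀ k n : ℕ, 1 ≤ k → (2 : ℝ) ^ k ≤ n → (n : ℝ) < 2 ^ (k + 1) →
      m * (k : ℝ) ^ γ₀ / 2 ^ k ≤ Real.log n ^ γ / (2 * n) := by
  have hlog2 : 0 < Real.log 2 := Real.log_pos one_lt_two
  let m := min (Real.log 2 ^ γ) ((2 * Real.log 2) ^ γ)
  have : 0 < m := by positivity
  refine ⟨m / 4, by positivity, fun k n hk hkn hnk => ?_⟩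
  have hk : (1 : ℝ) ≤ k := by exact_mod_cast hk
  have hn : (0 : ℝ) < n := hkn.trans_lt' (by positivity)
  have hlog_ge : k * Real.log 2 ≤ Real.log n := by
    rw [← Real.log_pow]
    exact Real.log_le_log (by positivity) hkn
  have hlog_le : Real.log n ≤ (k + 1 : ℕ) * Real.log 2 := by
    rw [← Real.log_pow]
    exact Real.log_le_log hn hnk.le
  have hratio : Real.log n / k ∈ Set.Icc (Real.log 2) (2 * Real.log 2) := by
    rw [Set.mem_Icc, le_div_iff₀ (by positivity), div_le_iff₀ (by positivity)]
    push_cast at hlog_le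
    constructor <;> nlinarith
  have hpow : m * (k : ℝ) ^ γ₀ ≤ Real.log n ^ γ := by
    calc m * (k : ℝ) ^ γ₀ ≤ (Real.log n / k) ^ γ * (k : ℝ) ^ γ := by
          gcongr
          exact min_rpow_le_rpow γ hlog2 hratio
      _ = Real.log n ^ γ := by
          rw [← Real.mul_rpow (hlog2.le.trans hratio.1) (by positivity),
            div_mul_cancel₀ _ (by positivity)]
  rw [pow_succ] at hnk
  calc m / 4 * (k : ℝ) ^ γ₀ / 2 ^ k = m * (k : ℝ) ^ γ₀ / (2 * (2 ^ k * 2)) := by ring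
    _ ≤ _ := by gcongr

theorem IsPolynomiallyBounded.tendsto_mul_div_pow_rpow {g : ℕ → ℝ} (hg : IsPolynomiallyBounded g)
    {a η : ℝ} (ha : 1 < a) (hη : 0 < η) :
    Tendsto (fun k => g k * (g k / a ^ k) ^ η) atTop (𝓝 0) := by
  have : 0 < a := zero_lt_one.trans ha
  have hlim := ((hg.rpow η⁻¹).mul hg).tendsto_div_pow ha |>.rpow_const (Or.inr hη.le)
  rw [Real.zero_rpow hη.ne'] at hlim
  refine hlim.congr' (hg.eventually_pos.mono fun k hk => ?_)
  rw [mul_div_assoc, Real.mul_rpow (by positivity) (by positivity), Real.rpow_inv_rpow hk.le hη.ne']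

theorem exists_forall_le_of_holderOnWith {L η : NNReal} (hρ : HolderOnWith L η ρ X)
    (hX : Bornology.IsBounded X) : ∃ S : NNReal, ∀ x ∈ X, ρ x ≤ S := by
  rcases X.eq_empty_or_nonempty with rfl | ⟨y, hy⟩
  · exact ⟨0, by simp⟩
  refine ⟨(ρ y + L * Metric.diam X ^ (η : ℝ)).toNNReal, fun x hx => ?_⟩
  have hdist := (abs_le.1 (hρ.dist_le_of_le hx hy (Metric.dist_le_diam_of_mem hX hx hy))).2
  exact (by linarith : ρ x ≤ _).trans (Real.le_coe_toNNReal _)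

theorem withDensity_ofReal_le_smul (hX : MeasurableSet X) {S : NNReal} (hρ : ∀ x ∈ X, ρ x ≤ S) :
    (volume.restrict X).withDensity (fun x => ENNReal.ofReal (ρ x)) ≤ S • volume := by
  calc (volume.restrict X).withDensity (fun x => ENNReal.ofReal (ρ x))
      ≤ (volume.restrict X).withDensity fun _ => (S : ENNReal) :=
        withDensity_mono <| (ae_restrict_mem hX).mono fun x hx =>
          ENNReal.ofReal_le_of_le_toReal (hρ x hx)
    _ = (S : ENNReal) • volume.restrict X := withDensity_const _
    _ ≤ (S : ENNReal) • volume := by gcongr; exact Measure.restrict_le_self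
    _ = S • volume := rfl

theorem toNNReal_smul_restrict_le_withDensity {A : Set ℝ} (hA : MeasurableSet A) (hAX : A ⊆ X)
    {m : ℝ} (hρ : ∀ x ∈ A, m ≤ ρ x) : m.toNNReal • volume.restrict A ≤
      (volume.restrict X).withDensity (fun x => ENNReal.ofReal (ρ x)) := by
  calc m.toNNReal • volume.restrict A = (volume.restrict A).withDensity
        fun _ => ENNReal.ofReal m := (withDensity_const _).symm
    _ ≤ (volume.restrict A).withDensity (fun x => ENNReal.ofReal (ρ x)) :=
        withDensity_mono <| (ae_restrict_mem hA).mono fun x hx =>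
          ENNReal.ofReal_le_ofReal (hρ x hx)
    _ ≤ _ := Measure.le_iff.2 fun s hs => by
        rw [withDensity_apply _ hs, withDensity_apply _ hs]
        exact lintegral_mono'
          (Measure.restrict_mono le_rfl (Measure.restrict_mono_set volume hAX)) le_rfl

theorem lintegral_exp_neg_mul_density (hX : MeasurableSet X) (hXb : Bornology.IsBounded X)
    (hρ0 : ∀ x ∈ X, 0 ≤ ρ x) (hρ : AEMeasurable ρ (volume.restrict X)) {S : NNReal}
    (hρS : ∀ x ∈ X, ρ x ≤ S) {b : ℝ} (hb : 0 ≤ b) :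
    ∫⁻ y, ENNReal.ofReal (Real.exp (-b * ρ y))
        ∂(volume.restrict X).withDensity (fun x => ENNReal.ofReal (ρ x)) =
      ENNReal.ofReal (∫ x in X, ρ x * Real.exp (-b * ρ x)) := by
  have : IsFiniteMeasure (volume.restrict X) := isFiniteMeasure_restrict.2 hXb.measure_lt_top.ne
  have hexp : AEMeasurable (fun x => Real.exp (-b * ρ x)) (volume.restrict X) :=
    Real.measurable_exp.comp_aemeasurable (hρ.const_mul _)
  have hint : IntegrableOn (fun x => ρ x * Real.exp (-b * ρ x)) X := by
    refine Integrable.of_bound (hρ.mul hexp).aestronglyMeasurable S ?_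
    filter_upwards [ae_restrict_mem hX] with x hx
    have hx0 := hρ0 x hx
    rw [Real.norm_of_nonneg (by positivity)]
    refine (mul_le_of_le_one_right hx0 (Real.exp_le_one_iff.2 ?_)).trans (hρS x hx)
    nlinarith
  rw [ofReal_integral_eq_lintegral_ofReal hint,
    lintegral_withDensity_eq_lintegral_mul₀ hρ.ennreal_ofReal hexp.ennreal_ofReal]
  · exact setLIntegral_congr_fun hX fun x hx => (ENNReal.ofReal_mul (hρ0 x hx)).symm
  · filter_upwards [ae_restrict_mem hX] with x hx using mul_nonneg (hρ0 x hx) (Real.exp_nonneg _)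

theorem mul_sub_le_measureReal_closedBall [IsFiniteMeasure μ]
    (hμ : μ = (volume.restrict X).withDensity fun x => ENNReal.ofReal (ρ x)) {L η : NNReal}
    (hρ : HolderOnWith L η ρ X) {y r R : ℝ} (hy : y ∈ X) (hr : 0 ≤ r) (hrR : r ≤ R)
    (hball : Metric.closedBall y R ⊆ X) :
    (ρ y - L * R ^ (η : ℝ)) * (2 * r) ≤ μ.real (Metric.closedBall y r) := by
  have hle : ∀ x ∈ Metric.closedBall y R, ρ y - L * R ^ (η : ℝ) ≤ ρ x := fun x hx => by
    linarith [(abs_le.1 (hρ.dist_le_of_le (hball hx) hy (Metric.mem_closedBall.1 hx))).1]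
  refine le_trans ?_ (mul_le_measureReal_closedBall
    (hμ ▸ toNNReal_smul_restrict_le_withDensity measurableSet_closedBall hball hle) hr
    (Metric.closedBall_subset_closedBall hrR))
  gcongr
  exact Real.le_coe_toNNReal _

theorem tsum_lintegral_exp_ne_top (hX : MeasurableSet X) (hXb : Bornology.IsBounded X)
    (hρ0 : ∀ x ∈ X, 0 ≤ ρ x) (hρ : AEMeasurable ρ (volume.restrict X)) {S : NNReal}
    (hρS : ∀ x ∈ X, ρ x ≤ S) {b : ℕ → ℝ} (hb : ∀ k, 0 ≤ b k) (a : ℝ)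
    (hsum : Summable fun k => ∫ x in X, ρ x * Real.exp (-b k * ρ x)) :
    ∑' k, ∫⁻ y, ENNReal.ofReal (Real.exp (-(b k * ρ y - a)))
      ∂(volume.restrict X).withDensity (fun x => ENNReal.ofReal (ρ x)) ≠ ⊤ := by
  have hsplit : ∀ k y, ENNReal.ofReal (Real.exp (-(b k * ρ y - a))) =
      ENNReal.ofReal (Real.exp a) * ENNReal.ofReal (Real.exp (-b k * ρ y)) := fun k y => by
    rw [← ENNReal.ofReal_mul (Real.exp_nonneg _), ← Real.exp_add]
    ring_nf
  simp only [hsplit, lintegral_const_mul' _ _ ENNReal.ofReal_ne_top, ENNReal.tsum_mul_left,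
    lintegral_exp_neg_mul_density hX hXb hρ0 hρ hρS (hb _)]
  exact ENNReal.mul_ne_top ENNReal.ofReal_ne_top hsum.tsum_ofReal_ne_top

/-- On a ball of radius `R` the density varies by at most `L * R ^ η`, which changes the exponent by
a bounded amount along `R = g k / 2 ^ k`. -/
theorem ae_eventually_minReturnDist_lt_of_holderOnWith [IsProbabilityMeasure μ]
    (hf : MeasurePreserving f μ μ) (hXo : X.OrdConnected) (hXb : Bornology.IsBounded X)
    (hX : ∀ᵐ x ∂μ, x ∈ X) (hdec : ExpDecayOfCorrelations X f μ)
    (hshort : ShortRecurrenceBound X f μ) (hρ0 : ∀ x ∈ X, 0 ≤ ρ x)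
    (hμ : μ = (volume.restrict X).withDensity fun x => ENNReal.ofReal (ρ x)) {L η : NNReal}
    (hη : 0 < η) (hρ : HolderOnWith L η ρ X) {γ γ₀ : ℝ} (hγ : γ₀ ≤ γ) {r : ℕ → ℝ}
    (hr : ∀ᶠ n : ℕ in atTop, Real.log n ^ γ / (2 * n) < r n)
    (hsum : ∀ ε > (0 : ℝ), Summable fun k : ℕ =>
      ∫ x in X, ρ x * Real.exp (-ε * ((k + 1 : ℕ) : ℝ) ^ γ₀ * ρ x)) :
    ∀ᵐ x ∂μ, ∀ᶠ n in atTop, minReturnDist f n x < r n := by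
  have hXm := hXo.measurableSet
  obtain ⟨S, hρS⟩ := exists_forall_le_of_holderOnWith hρ hXb
  obtain ⟨m, hm, hmle⟩ := exists_le_log_rpow_div hγ
  have hg : IsPolynomiallyBounded fun k => m * (k : ℝ) ^ γ₀ :=
    (isPolynomiallyBounded_const hm).mul (isPolynomiallyBounded_natCast.rpow γ₀)
  have hreturn := ae_eventually_notMem_noReturnSet hf hXo hXb hX hdec hshort
    (hμ ▸ withDensity_ofReal_le_smul hXm hρS) one_half_pos one_half_lt_one one_lt_two hg
    (G := fun k y => m / 4 * (k : ℝ) ^ γ₀ * ρ y - L / 4) ?_ ?_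
  · filter_upwards [ae_eventually_minReturnDist_lt one_lt_two hreturn
      ((eventually_ge_atTop 1).mono fun k hk n => hmle k n hk)] with x hx
    filter_upwards [hx, hr] with n hn hrn using hn.trans hrn
  · filter_upwards [hg.eventually_pos,
      (hg.tendsto_mul_div_pow_rpow one_lt_two hη).eventually_le_const one_pos]
      with k hgk hsmall y hy hball
    have hmass := mul_sub_le_measureReal_closedBall hμ hρ hy
      (r := (1 - 1 / 2) * (m * (k : ℝ) ^ γ₀ / 2 ^ k)) (by positivity)
      (mul_le_of_le_one_left (by positivity) (by norm_num)) hball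
    calc m / 4 * (k : ℝ) ^ γ₀ * ρ y - L / 4
        ≤ m / 4 * (k : ℝ) ^ γ₀ * ρ y -
          L / 4 * (m * (k : ℝ) ^ γ₀ * (m * (k : ℝ) ^ γ₀ / 2 ^ k) ^ (η : ℝ)) := by
          gcongr
          exact mul_le_of_le_one_right (by positivity) hsmall
      _ = (1 - 1 / 2) * ((1 - 1 / 2) * 2 ^ k) *
          ((ρ y - L * (m * (k : ℝ) ^ γ₀ / 2 ^ k) ^ (η : ℝ)) *
            (2 * ((1 - 1 / 2) * (m * (k : ℝ) ^ γ₀ / 2 ^ k)))) := by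
          field_simp
          ring
      _ ≤ _ := by gcongr
  · rw [hμ]
    refine tsum_lintegral_exp_ne_top hXm hXb hρ0 ((hρ.continuousOn hη).aemeasurable hXm) hρS
      (fun k => by positivity) _ ((summable_nat_add_iff 1).1 ?_)
    simpa only [neg_mul] using hsum (m / 4) (by positivity)

end

/-! ### Almost sure lower bound -/

section

variable {X : Set ℝ} {f : ℝ → ℝ} {μ : Measure ℝ} {D δ : ℝ} {k : ℕ} {r : ℕ → ℝ}

theorem iUnion_cell (hδ : 0 < δ) : ⋃ i, cell δ i = Set.univ :=
  Set.iUnion_eq_univ_iff.2 fun x => ⟨⌊x / δ⌋, (mem_cell_iff hδ).2 rfl⟩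

theorem cell_subset_closedBall {i : ℤ} {x : ℝ} (hx : x ∈ cell δ i) :
    cell δ i ⊆ Metric.closedBall x δ := fun y hy => by
  rw [cell, Set.mem_Ico] at hx hy
  rw [Metric.mem_closedBall, Real.dist_eq, abs_le]
  constructor <;> linarith

theorem tsum_measure_cell (μ : Measure ℝ) (hδ : 0 < δ) : ∑' i, μ (cell δ i) = μ Set.univ := by
  rw [← iUnion_cell hδ, measure_iUnion (pairwise_disjoint_cell δ) (measurableSet_cell δ)]

theorem tsum_measure_cell_sq_le (μ : Measure ℝ) (hδ : 0 < δ) :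
    ∑' i, μ (cell δ i) ^ 2 ≤ ∫⁻ x, μ (Metric.closedBall x δ) ∂μ := by
  calc ∑' i, μ (cell δ i) ^ 2
      ≤ ∑' i, ∫⁻ x in cell δ i, μ (Metric.closedBall x δ) ∂μ := by
        refine ENNReal.tsum_le_tsum fun i => ?_
        rw [sq, ← setLIntegral_const]
        exact setLIntegral_mono' (measurableSet_cell δ i) fun x hx =>
          measure_mono (cell_subset_closedBall hx)
    _ = ∫⁻ x, μ (Metric.closedBall x δ) ∂μ := by
        rw [← lintegral_iUnion (measurableSet_cell δ) (pairwise_disjoint_cell δ), iUnion_cell hδ,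
          setLIntegral_univ]

theorem lintegral_measure_closedBall_ne_zero (hμ : μ ≠ 0) (hδ : 0 < δ) :
    ∫⁻ x, μ (Metric.closedBall x δ) ∂μ ≠ 0 := fun hzero => by
  have hsq := tsum_measure_cell_sq_le μ hδ
  rw [hzero, nonpos_iff_eq_zero, ENNReal.tsum_eq_zero] at hsq
  refine hμ (Measure.measure_univ_eq_zero.1 ?_)
  rw [← tsum_measure_cell μ hδ, ENNReal.tsum_eq_zero]
  exact fun i => pow_eq_zero_iff two_ne_zero |>.1 (hsq i)

theorem tsum_mul_shift_le (a : ℤ → ENNReal) (t : ℤ) :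
    ∑' i, a i * a (i + t) ≤ 2 * ∑' i, a i ^ 2 := by
  have hmul : ∀ x y : ENNReal, x * y ≤ x ^ 2 + y ^ 2 := fun x y => by
    rcases le_total x y with hxy | hxy
    · exact (mul_le_mul_left hxy y).trans (by rw [← sq]; exact le_add_self)
    · exact (mul_le_mul_right hxy x).trans (by rw [← sq]; exact le_self_add)
  have hshift : ∑' i, a (i + t) ^ 2 = ∑' i, a i ^ 2 :=
    (Equiv.addRight t).tsum_eq fun i => a i ^ 2
  calc ∑' i, a i * a (i + t) ≤ ∑' i, (a i ^ 2 + a (i + t) ^ 2) :=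
        ENNReal.tsum_le_tsum fun i => hmul _ _
    _ = 2 * ∑' i, a i ^ 2 := by rw [ENNReal.tsum_add, hshift, two_mul]

theorem closeReturnSet_inter_cell_subset (hδ : 0 < δ) (i : ℤ) :
    closeReturnSet X f k δ ∩ cell δ i ⊆
      ⋃ t ∈ Finset.Icc (-1 : ℤ) 1, cell δ i ∩ f^[k] ⁻¹' cell δ (i + t) := by
  rintro x ⟨⟨-, hx⟩, hxi⟩
  rw [Real.dist_eq, abs_le] at hx
  have hi := hxi
  rw [cell, Set.mem_Ico, ← div_lt_iff₀ hδ, ← le_div_iff₀ hδ] at hi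
  have hlower : f^[k] x / δ ≥ x / δ - 1 := by
    rw [ge_iff_le, sub_le_iff_le_add, div_add_one hδ.ne']
    gcongr
    linarith
  have hupper : f^[k] x / δ ≤ x / δ + 1 := by
    rw [div_add_one hδ.ne']
    gcongr
    linarith
  refine Set.mem_biUnion (x := ⌊f^[k] x / δ⌋ - i) (Finset.mem_coe.2 (Finset.mem_Icc.2 ⟨?_, ?_⟩))
    ⟨hxi, (mem_cell_iff hδ).2 (by ring)⟩
  · rw [le_sub_iff_add_le, Int.le_floor]
    push_cast
    linarith [hi.1]
  · rw [sub_le_iff_le_add, ← Int.lt_add_one_iff, Int.floor_lt]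
    push_cast
    linarith [hi.2]

theorem IsDecorrelated.measure_inter_le [IsFiniteMeasure μ] {A F : Set ℝ}
    (h : IsDecorrelated f μ D k A) (hF : MeasurableSet F) :
    μ (A ∩ f^[k] ⁻¹' F) ≤ (μ A + ENNReal.ofReal D) * μ F := by
  rw [← ofReal_measureReal, ← ofReal_measureReal (s := A), ← ofReal_measureReal (s := F)]
  refine (ENNReal.ofReal_le_ofReal (h.measureReal_inter_le hF le_rfl)).trans ?_
  rw [ENNReal.ofReal_mul' measureReal_nonneg]
  gcongr
  exact ENNReal.ofReal_add_le

theorem measure_closeReturnSet_le [IsProbabilityMeasure μ] (hδ : 0 < δ)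
    (h : ∀ i, IsDecorrelated f μ D k (cell δ i)) : μ (closeReturnSet X f k δ) ≤
      6 * ∫⁻ x, μ (Metric.closedBall x δ) ∂μ + 3 * ENNReal.ofReal D := by
  have hmass : ∀ t : ℤ, ∑' i, μ (cell δ (i + t)) = 1 := fun t => by
    rw [← measure_univ (μ := μ), ← tsum_measure_cell μ hδ]
    exact (Equiv.addRight t).tsum_eq fun i => μ (cell δ i)
  have hshift : ∀ t : ℤ, ∑' i, μ (cell δ i ∩ f^[k] ⁻¹' cell δ (i + t)) ≤
      2 * ∫⁻ x, μ (Metric.closedBall x δ) ∂μ + ENNReal.ofReal D := fun t => by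
    calc ∑' i, μ (cell δ i ∩ f^[k] ⁻¹' cell δ (i + t))
        ≤ ∑' i, (μ (cell δ i) * μ (cell δ (i + t)) + ENNReal.ofReal D * μ (cell δ (i + t))) :=
          ENNReal.tsum_le_tsum fun i =>
            ((h i).measure_inter_le (measurableSet_cell δ _)).trans_eq (add_mul _ _ _)
      _ = ∑' i, μ (cell δ i) * μ (cell δ (i + t)) + ENNReal.ofReal D := by
          rw [ENNReal.tsum_add, ENNReal.tsum_mul_left, hmass, mul_one]
      _ ≤ _ := by
          grw [tsum_mul_shift_le (fun i => μ (cell δ i)) t, tsum_measure_cell_sq_le μ hδ]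
  calc μ (closeReturnSet X f k δ)
      = μ (⋃ i, closeReturnSet X f k δ ∩ cell δ i) := by
        rw [← Set.inter_iUnion, iUnion_cell hδ, Set.inter_univ]
    _ ≤ ∑' i, ∑ t ∈ Finset.Icc (-1 : ℤ) 1, μ (cell δ i ∩ f^[k] ⁻¹' cell δ (i + t)) :=
        (measure_iUnion_le _).trans <| ENNReal.tsum_le_tsum fun i =>
          (measure_mono (closeReturnSet_inter_cell_subset hδ i)).trans
            (measure_biUnion_finset_le _ _)
    _ = ∑ t ∈ Finset.Icc (-1 : ℤ) 1, ∑' i, μ (cell δ i ∩ f^[k] ⁻¹' cell δ (i + t)) :=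
        Summable.tsum_finsetSum fun _ _ => ENNReal.summable
    _ ≤ 3 • (2 * ∫⁻ x, μ (Metric.closedBall x δ) ∂μ + ENNReal.ofReal D) :=
        Finset.sum_le_card_nsmul _ _ _ fun t _ => hshift t
    _ = _ := by
        rw [nsmul_eq_mul, mul_add, ← mul_assoc]
        norm_num

theorem ShortRecurrenceBound.ae_iterate_ne [IsFiniteMeasure μ] (h : ShortRecurrenceBound X f μ)
    (hX : ∀ᵐ x ∂μ, x ∈ X) : ∀ᵐ x ∂μ, ∀ j : ℕ, 1 ≤ j → f^[j] x ≠ x := by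
  obtain ⟨β, hβ, C, _, hbound⟩ := h.exists_measureReal_le
  have hlog : Tendsto (fun n : ℕ => Real.log n ^ 2) atTop atTop :=
    (tendsto_pow_atTop two_ne_zero).comp
      (Real.tendsto_log_atTop.comp tendsto_natCast_atTop_atTop)
  have hlim : Tendsto (fun n : ℕ => C * (n : ℝ) ^ (-(β / 2))) atTop (𝓝 0) := by
    simpa using ((tendsto_rpow_neg_atTop (half_pos hβ.1)).comp
      tendsto_natCast_atTop_atTop).const_mul C
  refine ae_all_iff.2 fun j => ?_
  rcases Nat.eq_zero_or_pos j with rfl | hj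
  · simp
  have hnull : μ.real {x ∈ X | f^[j] x = x} = 0 := by
    refine le_antisymm (ge_of_tendsto hlim ?_) measureReal_nonneg
    filter_upwards [hbound, hlog.eventually_ge_atTop (j : ℝ)] with n hn hjn
    refine (measureReal_mono ?_).trans (hn j hj hjn)
    rintro x ⟨hx, hfix⟩
    refine ⟨hx, ?_⟩
    rw [hfix, dist_self]
    positivity
  rw [measureReal_eq_zero_iff] at hnull
  filter_upwards [hX, measure_eq_zero_iff_ae_notMem.1 hnull] with x hx hxj _ hfix
  exact hxj ⟨hx, hfix⟩

theorem eventually_lt_of_tsum_lintegral_ne_top (hμ : μ ≠ 0) (hr : AntitoneOn r (Set.Ici 1))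
    (hsum : ∑' n : ℕ, ∫⁻ x, μ (Metric.closedBall x (r (n + 1))) ∂μ ≠ ⊤) (hδ : 0 < δ) :
    ∀ᶠ n in atTop, r n < δ := by
  obtain ⟨m, hm⟩ : ∃ m, r (m + 1) < δ := by
    by_contra! hge
    refine lintegral_measure_closedBall_ne_zero hμ hδ (nonpos_iff_eq_zero.1 ?_)
    exact ge_of_tendsto' (ENNReal.tendsto_atTop_zero_of_tsum_ne_top hsum) fun n =>
      lintegral_mono fun x => measure_mono (Metric.closedBall_subset_closedBall (hge n))
  filter_upwards [eventually_ge_atTop (m + 1)] with n hn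
  have hm1 : 1 ≤ m + 1 := Nat.le_add_left 1 m
  exact (hr hm1 (hm1.trans hn) hn).trans_lt hm

theorem ae_eventually_lt_dist_iterate [IsProbabilityMeasure μ] (hf : Measurable f)
    (hX : ∀ᵐ x ∂μ, x ∈ X) (hdec : ExpDecayOfCorrelations X f μ)
    (hshort : ShortRecurrenceBound X f μ)
    (hsum : ∑' n : ℕ, ∫⁻ x, μ (Metric.closedBall x (r (n + 1))) ∂μ ≠ ⊤) :
    ∀ᵐ x ∂μ, ∀ᶠ k in atTop, r k < dist (f^[k] x) x := by
  obtain ⟨C, _, c, hc, hmix⟩ := hdec.exists_isDecorrelated hf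
  have hper := hshort.ae_iterate_ne hX
  have hbound : ∀ k : ℕ, μ (closeReturnSet X f (k + 1) (r (k + 1))) ≤
      6 * ∫⁻ x, μ (Metric.closedBall x (r (k + 1))) ∂μ +
        3 * ENNReal.ofReal (C * Real.exp (-c * (k + 1 : ℕ))) := fun k => by
    rcases lt_or_ge 0 (r (k + 1)) with hpos | hnonpos
    · exact measure_closeReturnSet_le hpos fun i => hmix _ _ (ordConnected_cell _ i)
    · have hnull : μ (closeReturnSet X f (k + 1) (r (k + 1))) = 0 :=
        measure_eq_zero_iff_ae_notMem.2 <| hper.mono fun x hx hclose =>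
          hx (k + 1) k.succ_pos (dist_le_zero.1 (hclose.2.trans hnonpos)).symm
      exact hnull.trans_le zero_le
  have hexp : Summable fun k : ℕ => C * Real.exp (-c * (k + 1 : ℕ)) := by
    simp only [mul_comm (-c)]
    exact ((summable_nat_add_iff 1).2
      (Real.summable_exp_nat_mul_iff.2 (neg_neg_of_pos hc))).mul_left C
  have hfinite : ∑' k : ℕ, μ (closeReturnSet X f (k + 1) (r (k + 1))) ≠ ⊤ := by
    refine ne_top_of_le_ne_top ?_ (ENNReal.tsum_le_tsum hbound)
    rw [ENNReal.tsum_add, ENNReal.tsum_mul_left, ENNReal.tsum_mul_left]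
    exact ENNReal.add_ne_top.2 ⟨ENNReal.mul_ne_top ENNReal.ofNat_ne_top hsum,
      ENNReal.mul_ne_top ENNReal.ofNat_ne_top hexp.tsum_ofReal_ne_top⟩
  filter_upwards [ae_eventually_notMem hfinite, hX] with x hx hxX
  rw [← map_add_atTop_eq_nat 1, eventually_map]
  refine hx.mono fun k hk => ?_
  by_contra! hle
  exact hk ⟨hxX, (dist_comm _ _).trans_le hle⟩

theorem eventually_lt_minReturnDist {x : ℝ} (hr : AntitoneOn r (Set.Ici 1))
    (hlim : ∀ δ > 0, ∀ᶠ n in atTop, r n < δ) (hper : ∀ j : ℕ, 1 ≤ j → f^[j] x ≠ x)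
    (hdist : ∀ᶠ k in atTop, r k < dist (f^[k] x) x) :
    ∀ᶠ n in atTop, r n < minReturnDist f n x := by
  obtain ⟨K, hK⟩ := eventually_atTop.1 hdist
  have hsmall : ∀ᶠ n in atTop, ∀ k ∈ Finset.Icc 1 K, r n < dist (f^[k] x) x :=
    (Filter.eventually_all_finset _).2 fun k hk =>
      hlim _ (dist_pos.2 (hper k (Finset.mem_Icc.1 hk).1))
  filter_upwards [hsmall, eventually_ge_atTop 1] with n hn hn1
  obtain ⟨k, hk, hmin⟩ : minReturnDist f n x ∈ (fun k => dist (f^[k] x) x) '' Set.Icc 1 n :=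
    Set.Nonempty.csInf_mem ⟨_, 1, ⟨le_rfl, hn1⟩, rfl⟩ ((Set.finite_Icc 1 n).image _)
  rw [← hmin]
  rcases le_total k K with hkK | hkK
  · exact hn k (Finset.mem_Icc.2 ⟨hk.1, hkK⟩)
  · exact (hr hk.1 hn1 hk.2).trans_lt (hK k hkK)

theorem ae_eventually_lt_minReturnDist [IsProbabilityMeasure μ] (hf : Measurable f)
    (hX : ∀ᵐ x ∂μ, x ∈ X) (hdec : ExpDecayOfCorrelations X f μ)
    (hshort : ShortRecurrenceBound X f μ) (hr : AntitoneOn r (Set.Ici 1))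
    (hsum : ∑' n : ℕ, ∫⁻ x, μ (Metric.closedBall x (r (n + 1))) ∂μ ≠ ⊤) :
    ∀ᵐ x ∂μ, ∀ᶠ n in atTop, r n < minReturnDist f n x := by
  filter_upwards [hshort.ae_iterate_ne hX, ae_eventually_lt_dist_iterate hf hX hdec hshort hsum]
    with x hper hdist
  exact eventually_lt_minReturnDist hr (fun δ => eventually_lt_of_tsum_lintegral_ne_top
    (IsProbabilityMeasure.ne_zero μ) hr hsum) hper hdist

end

theorem exists_forall_le_of_boundedVariationOn {X : Set ℝ} {ρ : ℝ → ℝ}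
    (hρ : BoundedVariationOn ρ X) : ∃ S : NNReal, ∀ x ∈ X, ρ x ≤ S := by
  rcases X.eq_empty_or_nonempty with rfl | ⟨y, hy⟩
  · exact ⟨0, by simp⟩
  refine ⟨(ρ y + (eVariationOn ρ X).toReal).toNNReal, fun x hx => ?_⟩
  linarith [hρ.sub_le hx hy, Real.le_coe_toNNReal (ρ y + (eVariationOn ρ X).toReal)]

namespace HyperbolicRecurrent

variable {X : Set ℝ} {f : ℝ → ℝ} {μ : Measure ℝ} {ρ : ℝ → ℝ}

theorem ae_mem (h : HyperbolicRecurrent X f μ ρ) : ∀ᵐ x ∂μ, x ∈ X := by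
  rw [h.eq_withDensity]
  exact (withDensity_absolutelyContinuous _ _).ae_le (ae_restrict_mem h.ordConnected.measurableSet)

theorem exists_le_smul_volume (h : HyperbolicRecurrent X f μ ρ) : ∃ S : NNReal, μ ≤ S • volume := by
  obtain ⟨S, hS⟩ := exists_forall_le_of_boundedVariationOn h.density_bv
  exact ⟨S, h.eq_withDensity ▸ withDensity_ofReal_le_smul h.ordConnected.measurableSet hS⟩

theorem sInf_smul_restrict_le (h : HyperbolicRecurrent X f μ ρ) :
    (sInf (ρ '' X)).toNNReal • volume.restrict X ≤ μ := by
  have hbdd : BddBelow (ρ '' X) := ⟨0, Set.forall_mem_image.2 h.density_nonneg⟩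
  exact h.eq_withDensity ▸ toNNReal_smul_restrict_le_withDensity h.ordConnected.measurableSet
    Set.Subset.rfl fun x hx => csInf_le hbdd (Set.mem_image_of_mem ρ hx)

theorem coe_toNNReal_sInf (h : HyperbolicRecurrent X f μ ρ) :
    ((sInf (ρ '' X)).toNNReal : ℝ) = sInf (ρ '' X) :=
  Real.coe_toNNReal _ (Real.sInf_nonneg (Set.forall_mem_image.2 h.density_nonneg))

end HyperbolicRecurrent

end Recurrence

theorem mainTheorem2_general {X : Set ℝ} {f : ℝ → ℝ} {μ : Measure ℝ} [IsProbabilityMeasure μ]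
    (hf : MeasurePreserving f μ μ) (hX : ∀ᵐ x ∂μ, x ∈ X)
    (hdec : Recurrence.ExpDecayOfCorrelations X f μ)
    (hshort : Recurrence.ShortRecurrenceBound X f μ) :
    (X.OrdConnected → Bornology.IsBounded X → ∀ (S m : NNReal) (c : ℝ) (r : ℕ → ℝ),
      μ ≤ S • volume → m • volume.restrict X ≤ μ → 1 < 2 * c * m →
      (∀ᶠ n : ℕ in atTop, c * Real.log (Real.log n) / n < r n) →
      ∀ᵐ x ∂μ, ∀ᶠ n : ℕ in atTop, Recurrence.minReturnDist f n x < r n) ∧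
    (X.OrdConnected → Bornology.IsBounded X → ∀ (ρ : ℝ → ℝ) (γ γ₀ : ℝ) (r : ℕ → ℝ),
      (∀ x ∈ X, 0 ≤ ρ x) → μ = (volume.restrict X).withDensity (fun x => ENNReal.ofReal (ρ x)) →
      (∃ (L η : NNReal), 0 < η ∧ HolderOnWith L η ρ X) →
      γ₀ ≤ γ → (∀ᶠ n : ℕ in atTop, Real.log n ^ γ / (2 * n) < r n) →
      (∀ ε > (0 : ℝ), Summable fun k : ℕ =>
        ∫ x in X, ρ x * Real.exp (-ε * ((k + 1 : ℕ) : ℝ) ^ γ₀ * ρ x)) →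
      ∀ᵐ x ∂μ, ∀ᶠ n : ℕ in atTop, Recurrence.minReturnDist f n x < r n) ∧
    (∀ r : ℕ → ℝ, AntitoneOn r (Set.Ici 1) →
      ∑' n : ℕ, ∫⁻ x, μ (Metric.closedBall x (r (n + 1))) ∂μ < ⊤ →
      ∀ᵐ x ∂μ, ∀ᶠ n : ℕ in atTop, r n < Recurrence.minReturnDist f n x) :=
  ⟨fun hXo hXb _ _ _ _ hμ hm hc hr =>
    Recurrence.ae_eventually_minReturnDist_lt_of_smul_le hf hXo hXb hX hdec hshort hμ hm hc hr,
   fun hXo hXb _ _ _ _ hρ0 hμ ⟨_, _, hη, hρ⟩ hγ hr hsum =>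
    Recurrence.ae_eventually_minReturnDist_lt_of_holderOnWith hf hXo hXb hX hdec hshort hρ0 hμ
      hη hρ hγ hr hsum,
   fun _ hr hsum =>
    Recurrence.ae_eventually_lt_minReturnDist hf.measurable hX hdec hshort hr hsum.ne⟩

theorem mainTheorem2 (X : Set ℝ) (f : ℝ → ℝ) (μ : Measure ℝ) (ρ : ℝ → ℝ)
    (h : Recurrence.HyperbolicRecurrent X f μ ρ) :
    -- upper bound, density bounded below
    (∀ (c : ℝ) (r : ℕ → ℝ), (∀ x ∈ X, 0 < ρ x) → 1 < 2 * c * sInf (ρ '' X) →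
      (∀ᶠ n : ℕ in atTop, c * Real.log (Real.log n) / n < r n) →
      ∀ᵐ x ∂μ, ∀ᶠ n : ℕ in atTop, Recurrence.minReturnDist f n x < r n) ∧
    -- upper bound, Hölder density
    (∀ (γ γ₀ : ℝ) (r : ℕ → ℝ), (∃ (L η : NNReal), 0 < η ∧ HolderOnWith L η ρ X) →
      γ₀ < γ → (∀ᶠ n : ℕ in atTop, Real.log n ^ γ / (2 * n) < r n) →
      (∀ ε > (0 : ℝ), Summable fun k : ℕ =>
        ∫ x in X, ρ x * Real.exp (-ε * ((k + 1 : ℕ) : ℝ) ^ γ₀ * ρ x)) →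
      ∀ᵐ x ∂μ, ∀ᶠ n : ℕ in atTop, Recurrence.minReturnDist f n x < r n) ∧
    -- lower bound
    (∀ r : ℕ → ℝ, AntitoneOn r (Set.Ici 1) →
      ∑' n : ℕ, ∫⁻ x, μ (Metric.closedBall x (r (n + 1))) ∂μ < ⊤ →
      ∀ᵐ x ∂μ, ∀ᶠ n : ℕ in atTop, r n < Recurrence.minReturnDist f n x) := by
  have := h.isProbabilityMeasure
  obtain ⟨S, hS⟩ := h.exists_le_smul_volume
  obtain ⟨hinf, hholder, hlower⟩ := mainTheorem2_general h.ergodic.toMeasurePreserving h.ae_mem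
    h.expDecay h.shortRecurrence
  exact ⟨fun c r _ hc hr => hinf h.ordConnected h.isBounded S _ c r hS h.sInf_smul_restrict_le
      (by rwa [h.coe_toNNReal_sInf]) hr,
    fun γ γ₀ r hρ hγ hr hsum => hholder h.ordConnected h.isBounded ρ γ γ₀ r h.density_nonneg
      h.eq_withDensity hρ hγ.le hr hsum,
    hlower⟩
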